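/- Let $V_3$ be the $18$-dimensional complex vector space of quadratic homogeneous vector fields $X=\sum_{i=1}^3 P_i(z_1,z_2,z_3)\,\partial/\partial z_i$ on $\mathbb{C}^3$. A radial orbit of $X$ is a line through the origin of $\mathbb{C}^3$ that is invariant by $X$; it is nondegenerate if $X$ does not vanish on it outside the origin, and $X$ is nondegenerate if all its radial orbits are. A nondegenerate radial orbit contains a unique point $a\neq 0$ with $P_i(a)=a_i$ for all $i$; its Kowalevski exponents are the two roots (with multiplicity) of $\det\big([\mathbb{I}-M]-\lambda\mathbb{I}\big)/(\lambda+1)$, where $M=\big(\partial P_i/\partial z_j(a)\big)_{i,j}$. Let $\Psi\colon V_3\dashrightarrow \mathrm{Sym}^7\big(\mathrm{Sym}^2(\mathbb{C})\big)$ be the partial map, defined on the set of nondegenerate vector fields having exactly seven radial orbits, that associates to a vector field the unordered collection (with repetitions) of the seven unordered pairs of Kowalevski exponents of its radial orbits. Then $\Psi$ is generically defined and, up to linear equivalence, has finite generic fibers: there is a nonempty Zariski-open subset $U\subset V_3$ such that every $X\in U$ is in the domain of $\Psi$ and the vector fields $Y$ in the domain of $\Psi$ with $\Psi(Y)=\Psi(X)$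 belong to finitely many classes of linear equivalence (where $X$ and $Y$ are linearly equivalent if some invertible linear change of coordinates of $\mathbb{C}^3$ maps one to the other). -/

import Mathlib

noncomputable section

/-- The space `V_n` of quadratic homogeneous vector fields `∑ P_i ∂/∂z_i` on `ℂ^n`, a vector field
being given by its components `P_i`. -/
abbrev QuadVF (n : ℕ) : Type :=
  Fin n → MvPolynomial.homogeneousSubmodule (Fin n) ℂ 2

namespace QuadVF

variable {n : ℕ}

/-- The value at the point `z` of the vector field `X`. -/
def value (X : QuadVF n) (z : Fin n → ℂ) : Fin n → ℂ :=
  fun i => MvPolynomial.eval z (X i : MvPolynomial (Fin n) ℂ)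

/-- The matrix `M_ij = ∂P_i/∂z_j (a)`. -/
def jacobian (X : QuadVF n) (a : Fin n → ℂ) : Matrix (Fin n) (Fin n) ℂ :=
  Matrix.of fun i j =>
    MvPolynomial.eval a (MvPolynomial.pderiv j (X i : MvPolynomial (Fin n) ℂ))

/-- The radial orbits of `X`: the lines through the origin of `ℂ^n` that are invariant by `X`. -/
def RadialOrbit (X : QuadVF n) : Type :=
  {ρ : Projectivization ℂ (Fin n → ℂ) // ∀ z ∈ ρ.submodule, X.value z ∈ ρ.submodule}

/-- A radial orbit is nondegenerate if `X` vanishes at none of its points but the origin. -/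
def RadialOrbit.IsNondegenerate {X : QuadVF n} (ρ : X.RadialOrbit) : Prop :=
  ∀ z ∈ ρ.1.submodule, z ≠ 0 → X.value z ≠ 0

/-- A vector field is nondegenerate if all its radial orbits are. -/
def IsNondegenerate (X : QuadVF n) : Prop :=
  ∀ ρ : X.RadialOrbit, ρ.IsNondegenerate

theorem value_smul (X : QuadVF n) (c : ℂ) (z : Fin n → ℂ) :
    X.value (c • z) = c ^ 2 • X.value z := by
  funext i
  have h : (X i : MvPolynomial (Fin n) ℂ).IsHomogeneous 2 := (X i).2
  simp only [value, Pi.smul_apply, smul_eq_mul, MvPolynomial.eval_eq, Finset.mul_sum]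
  refine Finset.sum_congr rfl fun d hd => ?_
  have hdeg : ∑ j ∈ d.support, d j = 2 := by
    have := h (MvPolynomial.mem_support_iff.mp hd)
    simpa [Finsupp.weight_apply, Finsupp.sum] using this
  simp only [mul_pow, Finset.prod_mul_distrib,
    Finset.prod_pow_eq_pow_sum, hdeg]
  ring

/-- A nondegenerate radial orbit contains exactly one point `a ≠ 0` with `P_i(a) = a_i`. -/
theorem RadialOrbit.IsNondegenerate.existsUnique {X : QuadVF n} {ρ : X.RadialOrbit}
    (hρ : ρ.IsNondegenerate) :
    ∃! a : Fin n → ℂ, a ∈ ρ.1.submodule ∧ a ≠ 0 ∧ X.value a = a := by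
  have hz : ρ.1.rep ∈ ρ.1.submodule := by
    rw [Projectivization.submodule_eq]; exact Submodule.mem_span_singleton_self _
  have hz0 : ρ.1.rep ≠ 0 := ρ.1.rep_nonzero
  have hmem : ∀ w ∈ ρ.1.submodule, ∃ c : ℂ, c • ρ.1.rep = w := fun w hw => by
    rw [Projectivization.submodule_eq] at hw; exact Submodule.mem_span_singleton.mp hw
  obtain ⟨c, hc⟩ := hmem _ (ρ.2 _ hz)
  have hc0 : c ≠ 0 := by
    rintro rfl
    exact hρ _ hz hz0 (by rw [← hc, zero_smul])
  refine ⟨c⁻¹ • ρ.1.rep, ⟨Submodule.smul_mem _ _ hz, smul_ne_zero (inv_ne_zero hc0) hz0, ?_⟩, ?_⟩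
  · rw [value_smul, ← hc, smul_smul]
    congr 1
    field_simp
  · rintro b ⟨hb, hb0, hbb⟩
    obtain ⟨d, rfl⟩ := hmem b hb
    have hd0 : d ≠ 0 := by rintro rfl; simp at hb0
    rw [value_smul, ← hc, smul_smul] at hbb
    have h1 : d ^ 2 * c = d := smul_left_injective ℂ hz0 hbb
    have h2 : d * c = 1 := by
      apply mul_left_cancel₀ hd0
      linear_combination h1
    rw [eq_inv_of_mul_eq_one_left h2]

/-- The point `a ≠ 0` of a nondegenerate radial orbit at which `P_i(a) = a_i`. -/
def RadialOrbit.point {X : QuadVF n} (ρ : X.RadialOrbit) (hρ : ρ.IsNondegenerate) : Fin n → ℂ :=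
  hρ.existsUnique.choose

/-- The Kowalevski exponents of a nondegenerate radial orbit: the roots, with multiplicity, of the
characteristic polynomial of `I - M` divided by `λ + 1`, for `M` the Jacobian matrix at the
point `a` of the orbit with `P_i(a) = a_i`. -/
def RadialOrbit.exponents {X : QuadVF n} (ρ : X.RadialOrbit) (hρ : ρ.IsNondegenerate) :
    Multiset ℂ :=
  ((1 - X.jacobian (ρ.point hρ)).charpoly /ₘ (Polynomial.X - Polynomial.C (-1))).roots

theorem RadialOrbit.card_exponents {X : QuadVF 3} (ρ : X.RadialOrbit) (hρ : ρ.IsNondegenerate) :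
    (ρ.exponents hρ).card = 2 := by
  unfold RadialOrbit.exponents
  rw [← (IsAlgClosed.splits _).natDegree_eq_card_roots,
    Polynomial.natDegree_divByMonic _ (Polynomial.monic_X_sub_C _),
    Matrix.charpoly_natDegree_eq_dim, Polynomial.natDegree_X_sub_C, Fintype.card_fin]

/-- The two exponents of a nondegenerate radial orbit on `ℂ^3`, as an unordered pair. -/
def RadialOrbit.exponentPair {X : QuadVF 3} (ρ : X.RadialOrbit) (hρ : ρ.IsNondegenerate) :
    Sym ℂ 2 :=
  ⟨ρ.exponents hρ, ρ.card_exponents hρ⟩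

/-- The exponents of the radial orbits of a nondegenerate vector field on `ℂ^3` having exactly
seven of them, as an unordered set (with repetitions) of seven unordered pairs. -/
def allExponents (X : QuadVF 3) (hX : X.IsNondegenerate) (h7 : Nat.card X.RadialOrbit = 7) :
    Sym (Sym ℂ 2) 7 :=
  haveI : Finite X.RadialOrbit := Nat.finite_of_card_ne_zero (by omega)
  letI : Fintype X.RadialOrbit := Fintype.ofFinite _
  Sym.mk ((Finset.univ : Finset X.RadialOrbit).val.map fun ρ => ρ.exponentPair (hX ρ))
    ((Multiset.card_map _ _).trans
      ((Nat.card_eq_fintype_card (α := X.RadialOrbit)).symm.trans h7))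

/-- The map `Ψ : V_3 ⇢ Sym^7(Sym^2(ℂ))`, defined on the nondegenerate vector fields having exactly
seven radial orbits. -/
def Psi : QuadVF 3 →. Sym (Sym ℂ 2) 7 := fun X =>
  ⟨X.IsNondegenerate ∧ Nat.card X.RadialOrbit = 7, fun h => X.allExponents h.1 h.2⟩

/-- Linear equivalence: an invertible linear change of coordinates maps `X` to `Y`. -/
def LinearlyEquivalent (X Y : QuadVF n) : Prop :=
  ∃ g : (Fin n → ℂ) ≃ₗ[ℂ] (Fin n → ℂ), ∀ z, Y.value (g z) = g (X.value z)

/-- The coefficients of the components of `X`, linear coordinates on `V_n`. -/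
def coeffs (X : QuadVF n) : Fin n × (Fin n →₀ ℕ) → ℂ :=
  fun q => MvPolynomial.coeff q.2 (X q.1 : MvPolynomial (Fin n) ℂ)

/-- The property `p` holds for a generic vector field: it holds on a nonempty Zariski-open subset
of `V_n`, that is, wherever some polynomial in the coefficients that is not identically zero on
`V_n` does not vanish. -/
def Generically (p : QuadVF n → Prop) : Prop :=
  ∃ F : MvPolynomial (Fin n × (Fin n →₀ ℕ)) ℂ,
    (∃ X : QuadVF n, MvPolynomial.eval X.coeffs F ≠ 0) ∧
      ∀ X : QuadVF n, MvPolynomial.eval X.coeffs F ≠ 0 → p X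

end QuadVF

end

/-! Every radial orbit of a nondegenerate field carries one nonzero fixed point `a` of `X`. At `a`,
Euler's identity gives `M a = 2a`, so the exponents at `a` amount to the trace of `M` and the
determinant of `1 - M`. Six fixed points that do not lie on a conic determine the field, because a
quadratic map is a linear map on the six-dimensional space of quadratic monomials. Configurations of
six such points thus form a variety of dimension 18 (its ring is `ConfRing`), which parametrizes
fields with six marked fixed points. Moving three independent marked points to a prescribed position
uses up the linear group and leaves nine parameters.

Finiteness of the fibers is infinitesimal rigidity in characteristic zero. Of the fourteen numbers
attached to the seven orbits, nine suffice: six traces and three determinants. If every derivation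
of `ConfRing` killing these nine functions and the first three points vanishes, then all of
`ConfRing` is algebraic over them (`isAlgebraic_adjoin_of_derivation_eq_zero`), and a generic value
of the data has finitely many preimages (`exists_ne_zero_finite_specializations`). Rigidity is a
linear system with 36 unknowns and 36 equations, and its injectivity needs checking at one field
only (`eq_zero_of_linearization_base`).

Two things remain. A field `Y` with the same exponents as a generic `X` is not itself assumed
generic, so it must be proved that any six of its seven fixed points avoid all conics and that some
three of them are independent. This follows from the finiteness of the fixed points and the
nonvanishing of `det (1 - M)`, which `Y` shares with `X`, by a count of cubics through the eight
fixed points, origin included (`exists_affine_combination`, `eq_zero_of_conic`). Moreover, a generic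
field must be shown to be nondegenerate with exactly seven orbits. There are at least seven because
the simple fixed points of `x², y², z²` persist (`exists_eval_ne_zero_forall_exists_zero`), and at
most seven because generically all polynomials reduce, modulo `X(z) = z`, to the eight squarefree
monomials (`not_injective_of_det_elimMatrix`). -/

/-! ### Commutative algebra: persistence of solutions, algebraicity by derivations, specialization.
-/

/-- A closed point in the image of `Spec B → Spec ℂ[x]`, where `B` is a localization of an algebra
`S` at an element `g`, lifts to a complex point of `S` at which `g` does not vanish. -/
theorem exists_ringHom_of_comap_eq_ker {τ S B : Type} [Finite τ] [CommRing S] [CommRing B]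
    [Algebra (MvPolynomial τ ℂ) S] [Algebra (MvPolynomial τ ℂ) B] [Algebra S B]
    [IsScalarTower (MvPolynomial τ ℂ) S B] (g : S) (hg : IsUnit (algebraMap S B g))
    [Algebra.FiniteType (MvPolynomial τ ℂ) B] (x : τ → ℂ) (q : PrimeSpectrum B)
    (hq : Ideal.comap (algebraMap (MvPolynomial τ ℂ) B) q.asIdeal =
      RingHom.ker (MvPolynomial.eval x)) :
    ∃ χ : S →+* ℂ, (∀ a, χ (algebraMap (MvPolynomial τ ℂ) S a) = MvPolynomial.eval x a) ∧
      χ g ≠ 0 := by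
  -- The quotient by a maximal ideal is `ℂ` by the Nullstellensatz. Enlarging `q` to `N` is
  -- harmless: `N` still contains the image of the ideal of the point `x`.
  obtain ⟨N, hN, hqN⟩ := Ideal.exists_le_maximal q.asIdeal q.2.ne_top
  have hker : ∀ a, MvPolynomial.eval x a = 0 → algebraMap (MvPolynomial τ ℂ) B a ∈ N := by
    intro a ha
    apply hqN
    rw [← Ideal.mem_comap, hq]
    exact ha
  let : Algebra ℂ B := ((algebraMap (MvPolynomial τ ℂ) B).comp MvPolynomial.C).toAlgebra
  have : IsScalarTower ℂ (MvPolynomial τ ℂ) B := IsScalarTower.of_algebraMap_eq fun _ => rfl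
  let : Field (B ⧸ N) := Ideal.Quotient.field N
  have : Algebra.FiniteType ℂ B :=
    Algebra.FiniteType.trans (S := MvPolynomial τ ℂ) inferInstance inferInstance
  have : Algebra.FiniteType ℂ (B ⧸ N) := inferInstance
  have : Module.Finite ℂ (B ⧸ N) := finite_of_finite_type_of_isJacobsonRing ℂ (B ⧸ N)
  have hbij := IsAlgClosed.algebraMap_bijective_of_isIntegral (k := ℂ) (K := B ⧸ N)
  let e : ℂ ≃ₐ[ℂ] (B ⧸ N) := AlgEquiv.ofBijective (Algebra.ofId ℂ (B ⧸ N)) hbij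
  let χ : B →ₐ[ℂ] ℂ := e.symm.toAlgHom.comp (Ideal.Quotient.mkₐ ℂ N)
  have hχN : ∀ b ∈ N, χ b = 0 := by
    intro b hb
    simp [χ, Ideal.Quotient.eq_zero_iff_mem.2 hb]
  refine ⟨χ.toRingHom.comp (algebraMap S B), fun a => ?_, (hg.map χ).ne_zero⟩
  change χ (algebraMap S B (algebraMap (MvPolynomial τ ℂ) S a)) = _
  rw [← IsScalarTower.algebraMap_apply]
  have h2 : χ (algebraMap (MvPolynomial τ ℂ) B (a - MvPolynomial.C (MvPolynomial.eval x a))) = 0 :=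
    hχN _ (hker _ (by simp))
  have h3 : χ (algebraMap (MvPolynomial τ ℂ) B (MvPolynomial.C (MvPolynomial.eval x a))) =
      MvPolynomial.eval x a := χ.commutes _
  rwa [map_sub, map_sub, h3, sub_eq_zero] at h2

open MvPolynomial in
/-- A nondegenerate zero `y₀` of a square system of polynomial equations depending polynomially on
parameters persists for generic values of the parameters. -/
theorem exists_eval_ne_zero_forall_exists_zero {τ σ : Type} [Finite τ] [Fintype σ] [DecidableEq σ]
    (H : σ → MvPolynomial σ (MvPolynomial τ ℂ)) (G : MvPolynomial σ (MvPolynomial τ ℂ))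
    (x₀ : τ → ℂ) (y₀ : σ → ℂ) (hH : ∀ i, eval₂ (eval x₀) y₀ (H i) = 0)
    (hG : eval₂ (eval x₀) y₀ G ≠ 0)
    (hJ : (Matrix.of fun i j => eval₂ (eval x₀) y₀ (pderiv i (H j))).det ≠ 0) :
    ∃ F : MvPolynomial τ ℂ, eval x₀ F ≠ 0 ∧ ∀ x, eval x F ≠ 0 →
      ∃ y : σ → ℂ, (∀ i, eval₂ (eval x) y (H i) = 0) ∧ eval₂ (eval x) y G ≠ 0 := by
  let A := MvPolynomial τ ℂ
  let I : Ideal (MvPolynomial σ A) := Ideal.span (Set.range H)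
  let S := MvPolynomial σ A ⧸ I
  let J : MvPolynomial σ A := (Matrix.of fun i j => pderiv i (H j)).det
  -- Inverting the Jacobian makes the algebra standard smooth; inverting `G` keeps the open
  -- condition.
  let g : S := Ideal.Quotient.mk I (J * G)
  let B := Localization.Away g
  let P : Algebra.PreSubmersivePresentation A S σ σ :=
    Algebra.PreSubmersivePresentation.naive id Function.injective_id
  let Q : Algebra.PreSubmersivePresentation S B Unit Unit :=
    Algebra.PreSubmersivePresentation.localizationAway B g
  have hgu : IsUnit (algebraMap S B g) := IsLocalization.Away.algebraMap_isUnit g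
  have hPJ : P.jacobian = Ideal.Quotient.mk I J := by
    rw [Algebra.PreSubmersivePresentation.jacobian_eq_jacobiMatrix_det]
    have : P.jacobiMatrix = Matrix.of fun i j => pderiv i (H j) := by
      ext1 i j
      exact Algebra.PreSubmersivePresentation.jacobiMatrix_naive _ _ _ _ _ _
    rw [this]
    change _ = Ideal.Quotient.mk I (Matrix.of fun i j => pderiv i (H j)).det
    rw [P.algebraMap_eq]
    congr 1
    have : (aeval P.val : MvPolynomial σ A →ₐ[A] S) = Ideal.Quotient.mkₐ A I := by
      ext i
      simp [P, Algebra.PreSubmersivePresentation.naive, Algebra.Presentation.naive,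
        Algebra.Generators.naive, I, S]
    exact congrArg (fun f : MvPolynomial σ A →ₐ[A] S => (f : MvPolynomial σ A →+* S)) this
  have hunit : IsUnit (Q.comp P).jacobian := by
    rw [Algebra.PreSubmersivePresentation.comp_jacobian_eq_jacobian_smul_jacobian,
      Algebra.PreSubmersivePresentation.localizationAway_jacobian, Algebra.smul_def, hPJ]
    refine IsUnit.mul ?_ hgu
    have h := hgu
    simp only [g, map_mul] at h
    exact isUnit_of_mul_isUnit_left h
  have : Algebra.IsStandardSmooth A B :=
    (Algebra.SubmersivePresentation.mk (Q.comp P) hunit).isStandardSmooth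
  have : Algebra.Smooth A B := inferInstance
  -- A smooth algebra is flat and finitely presented, so its map on spectra is open. Any basic open
  -- set around `x₀` inside the image provides `F`.
  have hopen := (PrimeSpectrum.isOpenMap_comap_of_hasGoingDown_of_finitePresentation
    (R := A) (S := B)).isOpen_range
  -- the given point
  let e₀ : MvPolynomial σ A →+* ℂ := eval₂Hom (eval x₀) y₀
  have hJ' : e₀ J ≠ 0 := by
    change e₀ (Matrix.of fun i j => pderiv i (H j)).det ≠ 0
    rw [RingHom.map_det]
    exact hJ
  let ψ : S →+* ℂ := Ideal.Quotient.lift I e₀ (by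
    intro a ha
    have : I ≤ RingHom.ker e₀ := by
      rw [Ideal.span_le]
      rintro _ ⟨i, rfl⟩
      exact hH i
    exact this ha)
  have hlift : ∀ a, ψ (Ideal.Quotient.mk I a) = e₀ a := fun a => rfl
  have hψg : IsUnit (ψ g) := by
    have : ψ g = e₀ J * e₀ G := (hlift _).trans (map_mul _ _ _)
    rw [this]
    exact (mul_ne_zero hJ' hG).isUnit
  let Ψ : B →+* ℂ := IsLocalization.Away.lift g hψg
  have hmem : (⟨RingHom.ker (eval x₀ : A →+* ℂ), RingHom.ker_isPrime _⟩ : PrimeSpectrum A) ∈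
      Set.range (PrimeSpectrum.comap (algebraMap A B)) := by
    refine ⟨⟨RingHom.ker Ψ, RingHom.ker_isPrime _⟩, ?_⟩
    ext a
    simp only [PrimeSpectrum.comap_asIdeal, Ideal.mem_comap, RingHom.mem_ker]
    have : Ψ (algebraMap A B a) = eval x₀ a := by
      rw [IsScalarTower.algebraMap_apply A S B, IsLocalization.Away.lift_eq]
      change ψ (Ideal.Quotient.mk I (C a)) = _
      rw [hlift]
      simp [e₀]
    rw [this]
  obtain ⟨_, ⟨F, rfl⟩, hxF, hF⟩ :=
    PrimeSpectrum.isTopologicalBasis_basic_opens.exists_subset_of_mem_open hmem hopen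
  refine ⟨F, hxF, fun x hx => ?_⟩
  obtain ⟨q, hq⟩ := hF (show (⟨RingHom.ker (eval x : A →+* ℂ), RingHom.ker_isPrime _⟩ :
    PrimeSpectrum A) ∈ _ from hx)
  obtain ⟨χ, hχ, hχg⟩ := exists_ringHom_of_comap_eq_ker (S := MvPolynomial σ A ⧸ I) (B := B) g hgu x
    q (congrArg PrimeSpectrum.asIdeal hq)
  let μ : MvPolynomial σ A →+* ℂ := χ.comp (Ideal.Quotient.mk I)
  have hμ : μ = eval₂Hom (eval x) (fun i => μ (X i)) :=
    MvPolynomial.ringHom_ext (fun a => (hχ a).trans (by simp)) (fun i => by simp)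
  refine ⟨fun i => μ (X i), fun i => ?_, ?_⟩
  · change eval₂Hom (eval x) (fun i => μ (X i)) (H i) = 0
    rw [← hμ]
    have : Ideal.Quotient.mk I (H i) = 0 :=
      Ideal.Quotient.eq_zero_iff_mem.2 (Ideal.subset_span ⟨i, rfl⟩)
    simp [μ, this]
  · change eval₂Hom (eval x) (fun i => μ (X i)) G ≠ 0
    rw [← hμ]
    have h2 : χ g = μ J * μ G := by
      rw [← map_mul]; rfl
    rw [h2] at hχg
    exact right_ne_zero_of_mul hχg

/-- If no nonzero derivation of a finitely generated domain over `ℂ` kills `s`, then the domain is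
algebraic over the subalgebra generated by `s`. -/
theorem isAlgebraic_adjoin_of_derivation_eq_zero {R : Type} [CommRing R] [IsDomain R] [Algebra ℂ R]
    [Algebra.FiniteType ℂ R] (s : Set R)
    (h : ∀ D : Derivation ℂ R (FractionRing R), (∀ a ∈ s, D a = 0) → D = 0) (x : R) :
    IsAlgebraic (Algebra.adjoin ℂ s) x := by
  let K := FractionRing R
  let A := Algebra.adjoin ℂ s
  let L := FractionRing A
  let : Algebra L K := FractionRing.liftAlgebra A K
  have : IsScalarTower A L K := FractionRing.isScalarTower_liftAlgebra A K
  have : IsScalarTower ℂ L K := IsScalarTower.of_algebraMap_eq fun z => by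
    rw [IsScalarTower.algebraMap_apply ℂ A L, ← IsScalarTower.algebraMap_apply A L K,
      ← IsScalarTower.algebraMap_apply ℂ A K]
  have : Algebra.EssFiniteType R K := Algebra.EssFiniteType.of_isLocalization K (nonZeroDivisors R)
  have : Algebra.EssFiniteType ℂ K := Algebra.EssFiniteType.comp ℂ R K
  have : Algebra.EssFiniteType L K := Algebra.EssFiniteType.of_comp ℂ L K
  have hder : ∀ D : Derivation L K K, D = 0 := by
    intro D
    let D₁ : Derivation ℂ R K := (D.restrictScalars ℂ).compAlgebraMap R
    have h1 : D₁ = 0 := h D₁ fun a ha => by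
      have : algebraMap R K a =
          algebraMap L K (algebraMap A L ⟨a, Algebra.subset_adjoin ha⟩) := by
        rw [← IsScalarTower.algebraMap_apply A L K]; rfl
      change D (algebraMap R K a) = 0
      rw [this, Derivation.map_algebraMap]
    have h2 : ∀ a : R, D (algebraMap R K a) = 0 := fun a => congrArg (fun d => d a) h1
    ext y
    obtain ⟨a, b, -, rfl⟩ := IsFractionRing.div_surjective (A := R) y
    rw [Derivation.leibniz_div, h2, h2]
    simp
  -- The dual of the space of differentials is the space of derivations, which is zero, and a vector
  -- space with zero dual is zero.
  have : Subsingleton (Ω[K⁄L]) := by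
    refine ⟨fun a b => ?_⟩
    rw [← sub_eq_zero]
    refine (Module.forall_dual_apply_eq_zero_iff K (a - b)).1 fun f => ?_
    have : f = 0 :=
      (KaehlerDifferential.linearMapEquivDerivation L K (M := K)).injective
        ((hder _).trans (hder _).symm)
    rw [this]; rfl
  have : Algebra.FormallyUnramified L K := ⟨inferInstance⟩
  have := Algebra.FormallyUnramified.isSeparable L K
  have hx : IsAlgebraic L (algebraMap R K x) := (Algebra.IsSeparable.isIntegral L _).isAlgebraic
  rw [← IsFractionRing.isAlgebraic_iff A L K] at hx
  exact (isAlgebraic_algebraMap_iff (FaithfulSMul.algebraMap_injective R K)).1 hx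

/-- Over a subalgebra, an algebraic element has only finitely many specializations compatible
with a given generic specialization of the subalgebra. -/
theorem exists_ne_zero_finite_specializations {R : Type} [CommRing R] [IsDomain R] [Algebra ℂ R]
    (s : Set R) (x : R) (hx : IsAlgebraic (Algebra.adjoin ℂ s) x) :
    ∃ c : R, c ≠ 0 ∧ ∀ φ : R →ₐ[ℂ] ℂ, φ c ≠ 0 →
      {w : ℂ | ∃ ψ : R →ₐ[ℂ] ℂ, (∀ a ∈ s, ψ a = φ a) ∧ ψ x = w}.Finite := by
  obtain ⟨q, hq0, hq⟩ := hx
  -- Where the leading coefficient survives, the relation `q` specializes to a nonzero polynomial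
  -- that depends only on the values of `φ` on `s`; all values `ψ x` are among its roots.
  refine ⟨(q.leadingCoeff : R), by simpa using hq0, fun φ hφ => ?_⟩
  let ι := (Algebra.adjoin ℂ s).val
  let Q : Polynomial ℂ := q.map (φ.comp ι).toRingHom
  have hQ : Q ≠ 0 := by
    intro h
    apply hφ
    have := congrArg (fun P => Polynomial.coeff P q.natDegree) h
    simpa [Q, Polynomial.coeff_map, ι] using this
  refine (Q.rootSet_finite ℂ).subset ?_
  rintro w ⟨ψ, hψ, rfl⟩
  rw [Polynomial.mem_rootSet]
  refine ⟨hQ, ?_⟩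
  have hagree : ψ.comp ι = φ.comp ι := by
    ext ⟨a, ha⟩
    change ψ a = φ a
    exact AlgHom.eqOn_adjoin_iff.2 (fun b hb => hψ b hb) ha
  have h1 := congrArg ψ hq
  rw [Polynomial.aeval_def, map_zero] at h1
  have h2 : ψ (Polynomial.eval₂ (algebraMap (Algebra.adjoin ℂ s) R) x q) =
      Polynomial.eval₂ (ψ.comp ι).toRingHom (ψ x) q := by
    exact Polynomial.hom_eval₂ q (algebraMap (Algebra.adjoin ℂ s) R) ψ.toRingHom x
  rw [h2, hagree] at h1
  simp only [Q, Polynomial.coe_aeval_eq_eval, Polynomial.eval_map]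
  exact h1

/-- The zero locus of an element that is algebraic over `ℂ[t]` maps into a hypersurface. -/
theorem exists_ne_zero_forall_eval_eq_zero {R τ : Type} [CommRing R] [IsDomain R] [Algebra ℂ R]
    (t : τ → R) (x : R) (hx : IsAlgebraic (Algebra.adjoin ℂ (Set.range t)) x) (hx0 : x ≠ 0) :
    ∃ F : MvPolynomial τ ℂ, F ≠ 0 ∧ ∀ φ : R →ₐ[ℂ] ℂ, φ x = 0 →
      MvPolynomial.eval (fun i => φ (t i)) F = 0 := by
  -- In a relation with nonzero constant term, setting `x` to zero leaves only that term, which is a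
  -- polynomial in `t`.
  obtain ⟨q, hq0, hq⟩ := hx.exists_nonzero_coeff_and_aeval_eq_zero
    (mem_nonZeroDivisors_of_ne_zero hx0)
  obtain ⟨F, hF⟩ := (Algebra.adjoin_range_eq_range_aeval ℂ t).le (q.coeff 0).2
  refine ⟨F, ?_, fun φ hφ => ?_⟩
  · rintro rfl
    apply hq0
    ext
    rw [← hF]; simp
  · have h1 : MvPolynomial.eval (fun i => φ (t i)) F = φ (MvPolynomial.aeval t F) := by
      rw [MvPolynomial.comp_aeval_apply, ← MvPolynomial.coe_aeval_eq_eval]; rfl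
    rw [h1]
    change φ (MvPolynomial.aeval t F) = 0
    change (MvPolynomial.aeval t) F = _ at hF
    rw [hF]
    have h2 := congrArg φ hq
    rw [Polynomial.aeval_def, map_zero] at h2
    have h3 : φ (Polynomial.eval₂ (algebraMap (Algebra.adjoin ℂ (Set.range t)) R) x q) =
        Polynomial.eval₂ (φ.comp (Algebra.adjoin ℂ (Set.range t)).val).toRingHom (φ x) q :=
      Polynomial.hom_eval₂ q (algebraMap (Algebra.adjoin ℂ (Set.range t)) R) φ.toRingHom x
    rw [h3, hφ, Polynomial.eval₂_at_zero] at h2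
    exact h2

/-- Injectivity of a matrix over a domain can be checked at a single specialization. -/
theorem eq_zero_of_mulVec_eq_zero_of_specialization {R κ ι : Type} [CommRing R] [IsDomain R]
    [Algebra ℂ R] [Fintype κ] [Fintype ι] [DecidableEq κ] [DecidableEq ι] (A : Matrix κ ι R)
    (φ : R →ₐ[ℂ] ℂ) (hφ : ∀ u : ι → ℂ, (A.map φ).mulVec u = 0 → u = 0)
    (u : ι → FractionRing R) (hu : (A.map (algebraMap R (FractionRing R))).mulVec u = 0) :
    u = 0 := by
  have hinj : Function.Injective (A.map φ).mulVecLin := by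
    rw [← LinearMap.ker_eq_bot, LinearMap.ker_eq_bot']
    exact hφ
  obtain ⟨g, hg⟩ := LinearMap.exists_leftInverse_of_injective _ (LinearMap.ker_eq_bot.2 hinj)
  let B : Matrix ι κ ℂ := LinearMap.toMatrix' g
  have hBA : B * A.map φ = 1 := by
    rw [← LinearMap.toMatrix'_id, ← hg, LinearMap.toMatrix'_comp]
    congr 1
    exact (LinearMap.toMatrix'_toLin' _).symm
  -- A left inverse at the special point, used as a constant matrix, gives a square matrix whose
  -- determinant specializes to 1 and is therefore nonzero generically.
  let C : Matrix ι ι R := B.map (algebraMap ℂ R) * A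
  have hC : φ C.det = 1 := by
    have : (C.map φ) = 1 := by
      rw [← hBA]
      ext i j
      simp [C, Matrix.mul_apply]
    have h2 := RingHom.map_det φ.toRingHom C
    change φ C.det = (C.map φ).det at h2
    rw [h2, this, Matrix.det_one]
  have hdet : (C.map (algebraMap R (FractionRing R))).det ≠ 0 := by
    have h2 := RingHom.map_det (algebraMap R (FractionRing R)) C
    rw [RingHom.mapMatrix_apply] at h2
    rw [← h2]
    simp only [ne_eq, FaithfulSMul.algebraMap_eq_zero_iff]
    intro h
    rw [h, map_zero] at hC
    exact zero_ne_one hC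
  refine Matrix.eq_zero_of_mulVec_eq_zero hdet ?_
  rw [Matrix.map_mul, ← Matrix.mulVec_mulVec, hu, Matrix.mulVec_zero]

/-! ### Quadratic monomials, and fields as matrices acting on them. -/

/-- The pairs of indices of the quadratic monomials in three variables. -/
def quadIdx : Fin 6 → Fin 3 × Fin 3 := ![(0, 0), (1, 1), (2, 2), (1, 2), (0, 2), (0, 1)]

/-- The Veronese map: the values of the six quadratic monomials. -/
def veronese {S : Type} [CommRing S] (z : Fin 3 → S) : Fin 6 → S :=
  fun J => z (quadIdx J).1 * z (quadIdx J).2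

/-- The matrix of the differential of the Veronese map. -/
def dVeronese {S : Type} [CommRing S] (z : Fin 3 → S) : Matrix (Fin 6) (Fin 3) S :=
  Matrix.of fun J j => (if j = (quadIdx J).1 then z (quadIdx J).2 else 0) +
    (if j = (quadIdx J).2 then z (quadIdx J).1 else 0)

section Veronese

variable {S : Type} [CommRing S]

open Matrix

theorem dVeronese_mulVec (z w : Fin 3 → S) (J : Fin 6) :
    (dVeronese z *ᵥ w) J =
      z (quadIdx J).1 * w (quadIdx J).2 + w (quadIdx J).1 * z (quadIdx J).2 := by
  simp only [Matrix.mulVec, dotProduct, dVeronese, Matrix.of_apply, add_mul, ite_mul, zero_mul,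
    Finset.sum_add_distrib, Finset.sum_ite_eq', Finset.mem_univ, if_true]
  ring

theorem veronese_add (z w : Fin 3 → S) :
    veronese (z + w) = veronese z + dVeronese z *ᵥ w + veronese w := by
  ext J
  simp only [Pi.add_apply, dVeronese_mulVec, veronese]
  ring

theorem veronese_smul (c : S) (z : Fin 3 → S) : veronese (c • z) = c ^ 2 • veronese z := by
  ext J
  simp only [Pi.smul_apply, smul_eq_mul, veronese]
  ring

theorem veronese_zero : veronese (0 : Fin 3 → S) = 0 := by
  ext J
  simp [veronese]

theorem dVeronese_smul (c : S) (z : Fin 3 → S) : dVeronese (c • z) = c • dVeronese z := by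
  ext J j
  simp only [dVeronese, Matrix.of_apply, Matrix.smul_apply, Pi.smul_apply, smul_eq_mul, mul_add,
    mul_ite, mul_zero]

/-- Euler's identity in degree two. It makes a fixed point an eigenvector of its Jacobian matrix
with eigenvalue 2, whence the root `-1` that is divided out of the characteristic polynomial. -/
theorem dVeronese_self (z : Fin 3 → S) : dVeronese z *ᵥ z = (2 : S) • veronese z := by
  ext J
  simp only [dVeronese_mulVec, veronese, Pi.smul_apply, smul_eq_mul]
  ring

theorem veronese_map {S' : Type} [CommRing S'] (φ : S →+* S') (z : Fin 3 → S) (J : Fin 6) :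
    φ (veronese z J) = veronese (fun i => φ (z i)) J := by
  simp [veronese]

theorem dVeronese_map {S' : Type} [CommRing S'] (φ : S →+* S') (z : Fin 3 → S) (J : Fin 6)
    (j : Fin 3) : φ (dVeronese z J j) = dVeronese (fun i => φ (z i)) J j := by
  simp only [dVeronese, Matrix.of_apply, map_add, apply_ite φ, map_zero]

/-- The action of a linear map on quadratic monomials. -/
def symSquare (A : Matrix (Fin 3) (Fin 3) S) : Matrix (Fin 6) (Fin 6) S :=
  Matrix.of fun I J => if (quadIdx J).1 = (quadIdx J).2 then
      A (quadIdx I).1 (quadIdx J).1 * A (quadIdx I).2 (quadIdx J).2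
    else A (quadIdx I).1 (quadIdx J).1 * A (quadIdx I).2 (quadIdx J).2 +
      A (quadIdx I).1 (quadIdx J).2 * A (quadIdx I).2 (quadIdx J).1

/-- This is what turns a linear change of coordinates into a product of coefficient matrices. -/
theorem veronese_mulVec (A : Matrix (Fin 3) (Fin 3) S) (z : Fin 3 → S) :
    veronese (A *ᵥ z) = symSquare A *ᵥ veronese z := by
  ext I
  simp only [veronese, symSquare, Matrix.mulVec, dotProduct, Matrix.of_apply, Fin.sum_univ_three,
    Fin.sum_univ_six]
  simp [quadIdx]
  ring

end Veronese

/-- The exponent vectors of the six quadratic monomials. -/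
noncomputable def quadMon (J : Fin 6) : Fin 3 →₀ ℕ :=
  Finsupp.single (quadIdx J).1 1 + Finsupp.single (quadIdx J).2 1

theorem quadMon_injective : Function.Injective quadMon := by
  intro I J h
  have h' : ∀ i, quadMon I i = quadMon J i := fun i => by rw [h]
  have h0 := h' 0
  have h1 := h' 1
  have h2 := h' 2
  fin_cases I <;> fin_cases J <;>
    simp [quadMon, quadIdx] at h0 h1 h2 ⊢

theorem exists_quadMon_eq (d : Fin 3 →₀ ℕ) (hd : d 0 + d 1 + d 2 = 2) : ∃ J, quadMon J = d := by
  have key : ∀ J : Fin 6, quadMon J 0 = d 0 → quadMon J 1 = d 1 → quadMon J 2 = d 2 →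
      ∃ J, quadMon J = d := fun J h0 h1 h2 => ⟨J, by
    ext i; fin_cases i; exacts [h0, h1, h2]⟩
  have h0 : d 0 ≤ 2 := by omega
  have h1 : d 1 ≤ 2 := by omega
  have h2 : d 2 = 2 - d 0 - d 1 := by omega
  rw [h2] at key
  generalize d 0 = a at *
  generalize d 1 = b at *
  interval_cases a <;> interval_cases b <;> first
    | omega
    | (refine key 0 ?_ ?_ ?_ <;> (simp [quadMon, quadIdx]; done))
    | (refine key 1 ?_ ?_ ?_ <;> (simp [quadMon, quadIdx]; done))
    | (refine key 2 ?_ ?_ ?_ <;> (simp [quadMon, quadIdx]; done))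
    | (refine key 3 ?_ ?_ ?_ <;> (simp [quadMon, quadIdx]; done))
    | (refine key 4 ?_ ?_ ?_ <;> (simp [quadMon, quadIdx]; done))
    | (refine key 5 ?_ ?_ ?_ <;> (simp [quadMon, quadIdx]; done))

/-- The quadratic form with given coefficients. -/
noncomputable def quadPoly {S : Type} [CommRing S] (c : Fin 6 → S) : MvPolynomial (Fin 3) S :=
  ∑ J, MvPolynomial.monomial (quadMon J) (c J)

section QuadPoly

open MvPolynomial Matrix

variable {S : Type} [CommRing S]

theorem coeff_quadPoly (c : Fin 6 → S) (J : Fin 6) : coeff (quadMon J) (quadPoly c) = c J := by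
  simp [quadPoly, coeff_sum, coeff_monomial, quadMon_injective.eq_iff]

theorem isHomogeneous_quadPoly (c : Fin 6 → S) : (quadPoly c).IsHomogeneous 2 := by
  refine IsHomogeneous.sum _ _ _ fun J _ => isHomogeneous_monomial _ ?_
  simp [quadMon, map_add]

theorem monomial_quadMon (c : S) (J : Fin 6) :
    monomial (quadMon J) c = C c * (X (quadIdx J).1 * X (quadIdx J).2) := by
  rw [X, X, monomial_mul, C_mul_monomial, quadMon]
  simp

theorem eval_quadPoly (c : Fin 6 → S) (z : Fin 3 → S) :
    eval z (quadPoly c) = c ⬝ᵥ veronese z := by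
  simp [quadPoly, monomial_quadMon, dotProduct, veronese]

theorem eval_pderiv_quadPoly (c : Fin 6 → S) (z : Fin 3 → S) (j : Fin 3) :
    eval z (pderiv j (quadPoly c)) = ∑ J, c J * dVeronese z J j := by
  simp only [quadPoly, monomial_quadMon, map_sum, Derivation.leibniz, pderiv_C,
    smul_eq_mul, map_mul, map_add, eval_C, eval_X, dVeronese, Matrix.of_apply,
    pderiv_X, Pi.single_apply, apply_ite (eval z), map_one, map_zero]
  refine Finset.sum_congr rfl fun J _ => ?_
  simp only [eq_comm (a := j), mul_ite, mul_one, mul_zero, mul_add]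
  ring

theorem eq_quadPoly_of_isHomogeneous {P : MvPolynomial (Fin 3) S} (hP : P.IsHomogeneous 2) :
    P = quadPoly fun J => coeff (quadMon J) P := by
  ext d
  by_cases hd : d 0 + d 1 + d 2 = 2
  · obtain ⟨J, rfl⟩ := exists_quadMon_eq d hd
    rw [coeff_quadPoly]
  · have hd' : d.degree ≠ 2 := by
      rwa [Finsupp.degree_eq_sum, Fin.sum_univ_three]
    rw [hP.coeff_eq_zero hd', (isHomogeneous_quadPoly _).coeff_eq_zero hd']

end QuadPoly

namespace QuadVF

open MvPolynomial Matrix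

/-- The coefficients of a quadratic vector field on `ℂ^3`, as a matrix. -/
noncomputable def coeffMatrix (X : QuadVF 3) : Matrix (Fin 3) (Fin 6) ℂ :=
  Matrix.of fun i J => coeff (quadMon J) (X i : MvPolynomial (Fin 3) ℂ)

/-- The quadratic vector field on `ℂ^3` with a given matrix of coefficients. -/
noncomputable def ofMatrix (T : Matrix (Fin 3) (Fin 6) ℂ) : QuadVF 3 :=
  fun i => ⟨quadPoly (T i), isHomogeneous_quadPoly _⟩

theorem coeffMatrix_ofMatrix (T : Matrix (Fin 3) (Fin 6) ℂ) : (ofMatrix T).coeffMatrix = T := by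
  ext i J
  exact coeff_quadPoly _ _

theorem eq_quadPoly (X : QuadVF 3) (i : Fin 3) :
    (X i : MvPolynomial (Fin 3) ℂ) = quadPoly (X.coeffMatrix i) :=
  eq_quadPoly_of_isHomogeneous (X i).2

theorem value_eq (X : QuadVF 3) (z : Fin 3 → ℂ) : X.value z = X.coeffMatrix *ᵥ veronese z := by
  ext i
  rw [value, eq_quadPoly, eval_quadPoly]
  rfl

theorem jacobian_eq (X : QuadVF 3) (z : Fin 3 → ℂ) :
    X.jacobian z = X.coeffMatrix * dVeronese z := by
  ext i j
  rw [jacobian, Matrix.of_apply, eq_quadPoly, eval_pderiv_quadPoly]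
  rfl

/-- A property of coefficient matrices holds generically. -/
def GenericallyMatrix (p : Matrix (Fin 3) (Fin 6) ℂ → Prop) : Prop :=
  ∃ F : MvPolynomial (Fin 3 × Fin 6) ℂ, F ≠ 0 ∧ ∀ T, eval (fun q => T q.1 q.2) F ≠ 0 → p T

theorem GenericallyMatrix.and {p q : Matrix (Fin 3) (Fin 6) ℂ → Prop} (hp : GenericallyMatrix p)
    (hq : GenericallyMatrix q) : GenericallyMatrix fun T => p T ∧ q T := by
  obtain ⟨F, hF, hFp⟩ := hp
  obtain ⟨G, hG, hGq⟩ := hq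
  refine ⟨F * G, mul_ne_zero hF hG, fun T hT => ?_⟩
  rw [map_mul] at hT
  exact ⟨hFp T (left_ne_zero_of_mul hT), hGq T (right_ne_zero_of_mul hT)⟩

/-- The coordinates of `coeffs` are indexed by all exponent vectors; only the eighteen of degree two
matter, and a polynomial in these is carried over by renaming its variables. -/
theorem GenericallyMatrix.generically {p : Matrix (Fin 3) (Fin 6) ℂ → Prop}
    (hp : GenericallyMatrix p) : Generically (n := 3) fun X => p X.coeffMatrix := by
  obtain ⟨F, hF, hFp⟩ := hp
  have key : ∀ X : QuadVF 3, eval X.coeffs (rename (fun q : Fin 3 × Fin 6 => (q.1, quadMon q.2)) F) =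
      eval (fun q => X.coeffMatrix q.1 q.2) F := fun X => by
    rw [eval_rename]; rfl
  refine ⟨rename (fun q : Fin 3 × Fin 6 => (q.1, quadMon q.2)) F, ?_, fun X hX => ?_⟩
  · obtain ⟨x, hx⟩ : ∃ x, eval x F ≠ 0 := by
      by_contra! h
      exact hF (MvPolynomial.funext fun x => by rw [h x, map_zero])
    refine ⟨ofMatrix (Matrix.of fun i J => x (i, J)), ?_⟩
    rw [key, coeffMatrix_ofMatrix]
    exact hx
  · rw [key] at hX
    exact hFp _ hX

end QuadVF

open Matrix

/-! ### Position of the fixed points of a field that has finitely many of them. -/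

section FixedPoints

variable {T : Matrix (Fin 3) (Fin 6) ℂ}

theorem mulVec_veronese_add (T : Matrix (Fin 3) (Fin 6) ℂ) (a d : Fin 3 → ℂ) (s : ℂ) :
    T *ᵥ veronese (a + s • d) =
      T *ᵥ veronese a + s • ((T * dVeronese a) *ᵥ d) + s ^ 2 • (T *ᵥ veronese d) := by
  rw [veronese_add, mulVec_add, mulVec_add, veronese_smul, mulVec_smul, mulVec_smul, mulVec_smul,
    ← mulVec_mulVec]

theorem not_forall_line_fixed (hfin : {z | T *ᵥ veronese z = z}.Finite) {a d : Fin 3 → ℂ}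
    (hd : d ≠ 0) : ¬ ∀ r : ℂ, T *ᵥ veronese (a + r • d) = a + r • d := by
  intro h
  have hinj : Function.Injective fun r : ℂ => a + r • d := fun r s hrs =>
    smul_left_injective ℂ hd (add_left_cancel hrs)
  exact Set.infinite_of_injective_forall_mem hinj (s := {z | T *ᵥ veronese z = z}) h hfin

/-- On the line through `a` and `b`, `X(z) - z` is quadratic in the parameter `s` and vanishes at 0
and 1, so it equals `s (s - 1) A`. A third zero forces `A = 0`, and then the whole line is fixed. -/
theorem not_fixed_of_collinear (hfin : {z | T *ᵥ veronese z = z}.Finite) {a b : Fin 3 → ℂ}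
    (ha : T *ᵥ veronese a = a) (hb : T *ᵥ veronese b = b) (hab : a ≠ b) {s : ℂ} (hs0 : s ≠ 0)
    (hs1 : s ≠ 1) : T *ᵥ veronese (a + s • (b - a)) ≠ a + s • (b - a) := by
  intro hs
  have h1 := mulVec_veronese_add T a (b - a) 1
  rw [one_smul, add_sub_cancel, hb, ha] at h1
  rw [mulVec_veronese_add, ha] at hs
  generalize (T * dVeronese a) *ᵥ (b - a) = B at h1 hs
  generalize hA : T *ᵥ veronese (b - a) = A at h1 hs
  have h2 : B + A = b - a := by
    ext i
    have := congrFun h1 i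
    simp only [Pi.add_apply, Pi.smul_apply, smul_eq_mul, Pi.sub_apply] at this ⊢
    linear_combination -this
  have hA0 : A = 0 := by
    ext i
    have e1 := congrFun h2 i
    have e2 := congrFun hs i
    simp only [Pi.add_apply, Pi.smul_apply, smul_eq_mul, Pi.sub_apply, Pi.zero_apply] at e1 e2 ⊢
    have : s * (s - 1) * A i = 0 := by linear_combination e2 - s * e1
    simpa [hs0, sub_eq_zero, hs1] using this
  refine not_forall_line_fixed hfin (a := a) (sub_ne_zero.2 hab.symm) fun r => ?_
  have hB : (T * dVeronese a) *ᵥ (b - a) = b - a := by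
    have h1 := mulVec_veronese_add T a (b - a) 1
    rw [one_smul, add_sub_cancel, hb, ha, hA, hA0, one_smul, smul_zero, add_zero] at h1
    rw [eq_sub_iff_add_eq, add_comm, ← h1]
  rw [mulVec_veronese_add, ha, hA, hA0, hB, smul_zero, add_zero]

/-- On a line through the origin homogeneity gives `X(t a) = t² a`, so only `t = 0` and `t = 1` give
fixed points. -/
theorem eq_zero_of_smul_add_smul_eq_zero {a b : Fin 3 → ℂ} (ha : T *ᵥ veronese a = a)
    (hb : T *ᵥ veronese b = b) (ha0 : a ≠ 0) (hb0 : b ≠ 0) (hab : a ≠ b) {x y : ℂ}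
    (h : x • a + y • b = 0) : x = 0 ∧ y = 0 := by
  have hy : y = 0 := by
    by_contra hy
    have hb' : b = (-(x / y)) • a := by
      ext i
      have := congrFun h i
      simp only [Pi.add_apply, Pi.smul_apply, smul_eq_mul, Pi.zero_apply] at this ⊢
      field_simp
      linear_combination this
    generalize -(x / y) = t at hb'
    have h2 : (t ^ 2 - t) • a = 0 := by
      have := hb
      rw [hb', veronese_smul, mulVec_smul, ha] at this
      rw [sub_smul, this, sub_self]
    have h3 : t * (t - 1) = 0 := by
      rcases smul_eq_zero.1 h2 with h | h
      · linear_combination h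
      · exact absurd h ha0
    rcases mul_eq_zero.1 h3 with rfl | h
    · exact hb0 (by rw [hb', zero_smul])
    · rw [sub_eq_zero] at h
      exact hab (by rw [hb', h, one_smul])
  refine ⟨?_, hy⟩
  rw [hy, zero_smul, add_zero] at h
  exact (smul_eq_zero.1 h).resolve_right ha0

theorem exists_eq_smul_add_smul {a b c w : Fin 3 → ℂ} (hw : w ≠ 0) (ha : a ⬝ᵥ w = 0)
    (hb : b ⬝ᵥ w = 0) (hc : c ⬝ᵥ w = 0)
    (hab : ∀ x y : ℂ, x • a + y • b = 0 → x = 0 ∧ y = 0) : ∃ x y : ℂ, c = x • a + y • b := by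
  have hdet : (Matrix.of ![a, b, c]).det = 0 := by
    rw [← Matrix.exists_mulVec_eq_zero_iff]
    refine ⟨w, hw, ?_⟩
    ext i
    fin_cases i
    exacts [ha, hb, hc]
  obtain ⟨v, hv0, hv⟩ := Matrix.exists_vecMul_eq_zero_iff.2 hdet
  have hsum : v 0 • a + v 1 • b + v 2 • c = 0 := by
    rw [← hv]
    ext i
    simp [Matrix.vecMul, dotProduct, Fin.sum_univ_three]
  have hv2 : v 2 ≠ 0 := by
    intro h
    rw [h, zero_smul, add_zero] at hsum
    obtain ⟨h0, h1⟩ := hab _ _ hsum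
    apply hv0
    ext i
    fin_cases i
    exacts [h0, h1, h]
  refine ⟨-(v 0 / v 2), -(v 1 / v 2), ?_⟩
  ext i
  have := congrFun hsum i
  simp only [Pi.add_apply, Pi.smul_apply, smul_eq_mul, Pi.zero_apply] at this ⊢
  field_simp
  linear_combination this

/-- No four nonzero fixed points lie in a plane through the origin. -/
theorem eq_zero_of_four_fixed (hfin : {z | T *ᵥ veronese z = z}.Finite) {p : Fin 4 → Fin 3 → ℂ}
    (hp : ∀ k, T *ᵥ veronese (p k) = p k) (hp0 : ∀ k, p k ≠ 0) (hinj : Function.Injective p)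
    {w : Fin 3 → ℂ} (hw : ∀ k, p k ⬝ᵥ w = 0) : w = 0 := by
  by_contra hw0
  have hind : ∀ k l, k ≠ l → ∀ x y : ℂ, x • p k + y • p l = 0 → x = 0 ∧ y = 0 :=
    fun k l hkl x y h => eq_zero_of_smul_add_smul_eq_zero (hp k) (hp l) (hp0 k) (hp0 l)
      (hinj.ne hkl) h
  have h01 := hind 0 1 (by decide)
  have key : ∀ m : Fin 4, m ≠ 0 → m ≠ 1 → ∃ x y : ℂ, p m = x • p 0 + y • p 1 ∧ x ≠ 0 ∧ y ≠ 0 := by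
    intro m hm0 hm1
    obtain ⟨x, y, hxy⟩ := exists_eq_smul_add_smul hw0 (hw 0) (hw 1) (hw m) h01
    refine ⟨x, y, hxy, ?_, ?_⟩
    · rintro rfl
      have := hind m 1 hm1 1 (-y) (by rw [hxy]; simp)
      exact one_ne_zero this.1
    · rintro rfl
      have := hind m 0 hm0 1 (-x) (by rw [hxy]; simp)
      exact one_ne_zero this.1
  obtain ⟨x, y, h2, hx, hy⟩ := key 2 (by decide) (by decide)
  obtain ⟨x', y', h3, hx', hy'⟩ := key 3 (by decide) (by decide)
  -- In the coordinates `(r, s)` of the plane spanned by `p 0` and `p 1`, the only unknown is the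
  -- cross term. That `p 2` is fixed puts it in this plane, as `m • p 0 + n • p 1`.
  have hval : ∀ r s : ℂ, T *ᵥ veronese (r • p 0 + s • p 1) =
      (r ^ 2) • p 0 + (r * s) • ((T * dVeronese (p 0)) *ᵥ p 1) + s ^ 2 • p 1 := by
    intro r s
    rw [mulVec_veronese_add, veronese_smul, mulVec_smul, hp, hp, dVeronese_smul, Matrix.mul_smul,
      Matrix.smul_mulVec, smul_smul, mul_comm s r]
  have hβ := hp 2
  rw [h2, hval] at hβ
  have hβ' := hp 3
  rw [h3, hval] at hβ'
  obtain ⟨m, n, hmn⟩ : ∃ m n : ℂ, (T * dVeronese (p 0)) *ᵥ p 1 = m • p 0 + n • p 1 := by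
    refine ⟨(x - x ^ 2) / (x * y), (y - y ^ 2) / (x * y), ?_⟩
    ext i
    have := congrFun hβ i
    simp only [Pi.add_apply, Pi.smul_apply, smul_eq_mul] at this ⊢
    field_simp
    linear_combination this
  rw [hmn] at hβ hβ'
  -- Off the two axes, being fixed amounts to two affine equations in `(r, s)`. They hold at `p 2`
  -- and `p 3`, hence on the line joining them, which would consist of fixed points.
  have hlin : ∀ r s : ℂ, r ≠ 0 → s ≠ 0 →
      (r ^ 2) • p 0 + (r * s) • (m • p 0 + n • p 1) + s ^ 2 • p 1 = r • p 0 + s • p 1 →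
      r + s * m = 1 ∧ s + r * n = 1 := by
    intro r s hr hs h
    have := h01 (r * (r + s * m - 1)) (s * (s + r * n - 1)) (by
      ext i
      have := congrFun h i
      simp only [Pi.add_apply, Pi.smul_apply, smul_eq_mul, Pi.zero_apply] at this ⊢
      linear_combination this)
    simp only [mul_eq_zero, hr, hs, false_or, sub_eq_zero] at this
    exact this
  obtain ⟨e1, e2⟩ := hlin x y hx hy hβ
  obtain ⟨e1', e2'⟩ := hlin x' y' hx' hy' hβ'
  refine not_forall_line_fixed hfin (a := p 2) (d := p 3 - p 2)
    (sub_ne_zero.2 (hinj.ne (by decide))) fun r => ?_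
  have hpt : p 2 + r • (p 3 - p 2) = (x + r * (x' - x)) • p 0 + (y + r * (y' - y)) • p 1 := by
    rw [h2, h3]
    ext i
    simp only [Pi.add_apply, Pi.smul_apply, smul_eq_mul, Pi.sub_apply]
    ring
  rw [hpt, hval, hmn]
  have f1 : (x + r * (x' - x)) + (y + r * (y' - y)) * m = 1 := by
    linear_combination (1 - r) * e1 + r * e1'
  have f2 : (y + r * (y' - y)) + (x + r * (x' - x)) * n = 1 := by
    linear_combination (1 - r) * e2 + r * e2'
  generalize x + r * (x' - x) = X at f1 f2 ⊢
  generalize y + r * (y' - y) = Y at f1 f2 ⊢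
  ext i
  simp only [Pi.add_apply, Pi.smul_apply, smul_eq_mul]
  linear_combination X * p 0 i * f1 + Y * p 1 i * f2

end FixedPoints

/-! ### Cubic polynomials through the eight fixed points, the origin included. -/

/-- The affine polynomial with given coefficients. -/
noncomputable def affPoly (l : Fin 4 → ℂ) : MvPolynomial (Fin 3) ℂ :=
  MvPolynomial.C (l 0) + ∑ i : Fin 3, MvPolynomial.C (l i.succ) * MvPolynomial.X i

theorem eval_affPoly (l : Fin 4 → ℂ) (z : Fin 3 → ℂ) :
    MvPolynomial.eval z (affPoly l) = l ⬝ᵥ Fin.cons 1 z := by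
  simp [affPoly, dotProduct, Fin.sum_univ_succ]

theorem totalDegree_affPoly_le (l : Fin 4 → ℂ) : (affPoly l).totalDegree ≤ 1 := by
  refine (MvPolynomial.totalDegree_add _ _).trans (max_le (by simp) ?_)
  refine MvPolynomial.totalDegree_finsetSum_le fun i _ => ?_
  refine (MvPolynomial.totalDegree_mul _ _).trans ?_
  simp

theorem affPoly_add (l m : Fin 4 → ℂ) : affPoly (l + m) = affPoly l + affPoly m := by
  simp only [affPoly, Pi.add_apply, map_add, add_mul, Finset.sum_add_distrib]
  ring

theorem affPoly_smul (c : ℂ) (l : Fin 4 → ℂ) : affPoly (c • l) = c • affPoly l := by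
  simp only [affPoly, Pi.smul_apply, smul_eq_mul, map_mul, MvPolynomial.smul_eq_C_mul, mul_add,
    Finset.mul_sum, mul_assoc]

/-- Functions on `Fin 3` of degree at most three: there are twenty of them. -/
theorem finrank_restrictTotalDegree_three_le :
    Module.finrank ℂ (MvPolynomial.restrictTotalDegree (Fin 3) ℂ 3) ≤ 20 := by
  have hb := MvPolynomial.basisRestrictSupport (σ := Fin 3) ℂ
    {n | (n.sum fun _ e => e) ≤ 3}
  let f : {n : Fin 3 →₀ ℕ | (n.sum fun _ e => e) ≤ 3} →
      {m : Fin 4 × Fin 4 × Fin 4 // m.1.val + m.2.1.val + m.2.2.val ≤ 3} := fun n => by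
    have h : n.1 0 + n.1 1 + n.1 2 ≤ 3 := by
      have := n.2
      rwa [Set.mem_ofPred_eq, Finsupp.sum_fintype _ _ (fun _ => rfl), Fin.sum_univ_three] at this
    exact ⟨(⟨n.1 0, by omega⟩, ⟨n.1 1, by omega⟩, ⟨n.1 2, by omega⟩), h⟩
  have hf : Function.Injective f := by
    intro m n h
    simp only [f, Subtype.mk.injEq, Prod.mk.injEq, Fin.mk.injEq] at h
    ext i
    fin_cases i
    exacts [h.1, h.2.1, h.2.2]
  have : Module.finrank ℂ (MvPolynomial.restrictTotalDegree (Fin 3) ℂ 3) =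
    Nat.card {n : Fin 3 →₀ ℕ | (n.sum fun _ e => e) ≤ 3} := Module.finrank_eq_nat_card_basis hb
  rw [this]
  refine (Nat.card_le_card_of_injective f hf).trans ?_
  rw [Nat.card_eq_fintype_card]
  decide

instance finite_restrictTotalDegree_three :
    Module.Finite ℂ (MvPolynomial.restrictTotalDegree (Fin 3) ℂ 3) := by
  have hb := MvPolynomial.basisRestrictSupport (σ := Fin 3) ℂ
    {n | (n.sum fun _ e => e) ≤ 3}
  have : Finite {n : Fin 3 →₀ ℕ | (n.sum fun _ e => e) ≤ 3} := by
    have hfin : Set.Finite {n : Fin 3 →₀ ℕ | ∀ i, n i ≤ 3} := by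
      have : {n : Fin 3 →₀ ℕ | ∀ i, n i ≤ 3} ⊆
          Set.Iic (Finsupp.equivFunOnFinite.symm fun _ => 3) := fun n hn i => hn i
      exact (Set.finite_Iic _).subset this
    refine hfin.subset fun n hn i => ?_
    rw [Set.mem_ofPred_eq, Finsupp.sum_fintype _ _ (fun _ => rfl)] at hn
    exact (Finset.single_le_sum (f := fun i => n i) (fun _ _ => Nat.zero_le _)
      (Finset.mem_univ i)).trans hn
  exact Module.Finite.of_basis hb

theorem exists_affine_of_notMem_span {s : Set (Fin 4 → ℂ)} {v : Fin 4 → ℂ}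
    (hv : v ∉ Submodule.span ℂ s) : ∃ l : Fin 4 → ℂ, l ⬝ᵥ v ≠ 0 ∧ ∀ w ∈ s, l ⬝ᵥ w = 0 := by
  obtain ⟨f, hf, hs⟩ := Submodule.exists_le_ker_of_notMem hv
  have key : ∀ w, (fun i => f fun j => if i = j then 1 else 0) ⬝ᵥ w = f w := fun w => by
    rw [LinearMap.pi_apply_eq_sum_univ f w, dotProduct]
    exact Finset.sum_congr rfl fun i _ => mul_comm _ _
  refine ⟨fun i => f fun j => if i = j then 1 else 0, by rwa [key], fun w hw => ?_⟩
  rw [key]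
  exact hs (Submodule.subset_span hw)

section EightPoints

variable {T : Matrix (Fin 3) (Fin 6) ℂ} {P : Fin 8 → Fin 3 → ℂ}

/-- The value at the origin kills the constant term. The linear part then vanishes at four nonzero
fixed points, which are not coplanar with the origin. -/
theorem eq_zero_of_affine_vanish (hfin : {z | T *ᵥ veronese z = z}.Finite)
    (hP : ∀ k, T *ᵥ veronese (P k) = P k) (hinj : Function.Injective P) (h0 : P 0 = 0)
    {l : Fin 4 → ℂ} (hl : ∀ k, l ⬝ᵥ Fin.cons 1 (P k) = 0) : l = 0 := by
  have hl' : ∀ k, l 0 + P k ⬝ᵥ (fun i => l i.succ) = 0 := fun k => by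
    rw [← hl k]
    simp [dotProduct, Fin.sum_univ_succ]
    ring
  have hl0 : l 0 = 0 := by
    have := hl' 0
    rwa [h0, zero_dotProduct, add_zero] at this
  have htail : (fun i : Fin 3 => l i.succ) = 0 := by
    refine eq_zero_of_four_fixed hfin (p := fun k : Fin 4 => P (Fin.natAdd 4 k)) (fun k => hP _)
      (fun k h => ?_) (fun a b h => ?_) fun k => ?_
    · have := hinj (h.trans h0.symm)
      have := congrArg Fin.val this
      simp only [Fin.val_natAdd, Fin.val_zero] at this
      omega
    · simpa [Fin.ext_iff] using hinj h
    · have := hl' (Fin.natAdd 4 k)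
      rwa [hl0, zero_add] at this
  ext i
  refine Fin.cases hl0 (fun i => ?_) i
  exact congrFun htail i

theorem cons_notMem_span_pair (hfin : {z | T *ᵥ veronese z = z}.Finite)
    {a b c : Fin 3 → ℂ} (ha : T *ᵥ veronese a = a) (hb : T *ᵥ veronese b = b)
    (hc : T *ᵥ veronese c = c) (hab : a ≠ b) (hac : a ≠ c) (hbc : b ≠ c) :
    (Fin.cons 1 c : Fin 4 → ℂ) ∉ Submodule.span ℂ {Fin.cons 1 a, Fin.cons 1 b} := by
  rw [Submodule.mem_span_pair]
  rintro ⟨s, t, hst⟩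
  have h1 : s + t = 1 := by
    have := congrFun hst 0
    simpa using this
  have h2 : c = a + t • (b - a) := by
    ext i
    have := congrFun hst i.succ
    simp only [Pi.add_apply, Pi.smul_apply, Fin.cons_succ, smul_eq_mul, Pi.sub_apply] at this ⊢
    linear_combination -this + a i * h1
  refine not_fixed_of_collinear hfin ha hb hab (s := t) ?_ ?_ (by rwa [← h2])
  · rintro rfl
    exact hac (by rw [h2]; simp)
  · rintro rfl
    exact hbc (by rw [h2]; simp)

/-- Cubic polynomials separate the eight fixed points. -/
theorem exists_three_affine (hfin : {z | T *ᵥ veronese z = z}.Finite)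
    (hP : ∀ k, T *ᵥ veronese (P k) = P k) (hinj : Function.Injective P) (h0 : P 0 = 0)
    (k : Fin 8) : ∃ l₁ l₂ l₃ : Fin 4 → ℂ, ∀ j,
      (l₁ ⬝ᵥ Fin.cons 1 (P j)) * (l₂ ⬝ᵥ Fin.cons 1 (P j)) * (l₃ ⬝ᵥ Fin.cons 1 (P j)) ≠ 0 ↔
        j = k := by
  -- The seven points other than `P k` are covered by three planes missing `P k`, in groups of 3, 2
  -- and 2. Pairs raise no difficulty, as no three points are collinear; the triple must be chosen.
  -- After `P k` is renumbered 0, some `m` is not coplanar with the points 0, 1, 2, and the triple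
  -- is `m, 1, 2`.
  let e₀ : Equiv.Perm (Fin 8) := Equiv.swap 0 k
  let v₀ : Fin 8 → Fin 4 → ℂ := fun j => Fin.cons 1 (P (e₀ j))
  obtain ⟨m, hm⟩ : ∃ m, v₀ m ∉ Submodule.span ℂ {v₀ 0, v₀ 1, v₀ 2} := by
    by_contra! h
    have hlt : Submodule.span ℂ {v₀ 0, v₀ 1, v₀ 2} ≠ ⊤ := by
      intro htop
      have h1 := finrank_span_le_card (R := ℂ) ({v₀ 0, v₀ 1, v₀ 2} : Set (Fin 4 → ℂ))
      rw [htop, finrank_top, Module.finrank_fin_fun] at h1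
      have h2 : ({v₀ 0, v₀ 1, v₀ 2} : Set (Fin 4 → ℂ)).toFinset.card ≤ 3 := by
        classical
        simp only [Set.toFinset_insert, Set.toFinset_singleton]
        exact Finset.card_le_three
      omega
    obtain ⟨w, hw⟩ : ∃ w, w ∉ Submodule.span ℂ {v₀ 0, v₀ 1, v₀ 2} := by
      by_contra! h'
      exact hlt (Submodule.eq_top_iff'.2 h')
    rw [← Submodule.span_eq (Submodule.span ℂ {v₀ 0, v₀ 1, v₀ 2})] at hw
    obtain ⟨l, hl, hl'⟩ := exists_affine_of_notMem_span hw
    have : l = 0 := eq_zero_of_affine_vanish hfin hP hinj h0 fun j => by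
      have := hl' _ (h (e₀.symm j))
      simpa [v₀] using this
    rw [this, zero_dotProduct] at hl
    exact hl rfl
  have hm0 : m ≠ 0 := by rintro rfl; exact hm (Submodule.subset_span (by simp))
  have hm1 : m ≠ 1 := by rintro rfl; exact hm (Submodule.subset_span (by simp))
  have hm2 : m ≠ 2 := by rintro rfl; exact hm (Submodule.subset_span (by simp))
  -- The point `m` is renumbered 3, so that the groups are `{3, 1, 2}`, `{4, 5}` and `{6, 7}`.
  let e : Equiv.Perm (Fin 8) := (Equiv.swap 3 m).trans e₀
  let v : Fin 8 → Fin 4 → ℂ := fun j => Fin.cons 1 (P (e j))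
  have he0 : e 0 = k := by
    simp [e, e₀, Equiv.swap_apply_of_ne_of_ne (show (0 : Fin 8) ≠ 3 by decide) hm0.symm]
  have hv0 : v 0 = v₀ 0 := by
    simp [v, v₀, e, Equiv.swap_apply_of_ne_of_ne (show (0 : Fin 8) ≠ 3 by decide) hm0.symm]
  have hv1 : v 1 = v₀ 1 := by
    simp [v, v₀, e, Equiv.swap_apply_of_ne_of_ne (show (1 : Fin 8) ≠ 3 by decide) hm1.symm]
  have hv2 : v 2 = v₀ 2 := by
    simp [v, v₀, e, Equiv.swap_apply_of_ne_of_ne (show (2 : Fin 8) ≠ 3 by decide) hm2.symm]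
  have hv3 : v 3 = v₀ m := by simp [v, v₀, e]
  have hpair : ∀ a b, a ≠ b → a ≠ 0 → b ≠ 0 → v 0 ∉ Submodule.span ℂ {v a, v b} := by
    intro a b hab ha hb
    have hne : ∀ i j, i ≠ j → P (e i) ≠ P (e j) := fun i j hij =>
      hinj.ne (e.injective.ne hij)
    exact cons_notMem_span_pair hfin (hP _) (hP _) (hP _) (hne _ _ hab) (hne _ _ ha) (hne _ _ hb)
  have htriple : v 0 ∉ Submodule.span ℂ {v 3, v 1, v 2} := by
    intro h
    have := mem_span_insert_exchange h (hpair 1 2 (by decide) (by decide) (by decide))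
    rw [hv0, hv1, hv2, hv3] at this
    exact hm this
  obtain ⟨l₁, hl₁, hl₁'⟩ := exists_affine_of_notMem_span htriple
  obtain ⟨l₂, hl₂, hl₂'⟩ := exists_affine_of_notMem_span
    (hpair 4 5 (by decide) (by decide) (by decide))
  obtain ⟨l₃, hl₃, hl₃'⟩ := exists_affine_of_notMem_span
    (hpair 6 7 (by decide) (by decide) (by decide))
  refine ⟨l₁, l₂, l₃, fun j => ?_⟩
  obtain ⟨i, rfl⟩ := e.surjective j
  change l₁ ⬝ᵥ v i * l₂ ⬝ᵥ v i * l₃ ⬝ᵥ v i ≠ 0 ↔ _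
  constructor
  · intro h
    by_contra hi
    apply h
    have : i = 0 ∨ i ∈ ({3, 1, 2} : Set (Fin 8)) ∨ i ∈ ({4, 5} : Set (Fin 8)) ∨
        i ∈ ({6, 7} : Set (Fin 8)) := by
      fin_cases i <;> simp
    rcases this with rfl | h | h | h
    · exact absurd he0 hi
    · rw [hl₁' (v i) (by rcases h with rfl | rfl | rfl <;> simp), zero_mul, zero_mul]
    · rw [hl₂' (v i) (by rcases h with rfl | rfl <;> simp), mul_zero, zero_mul]
    · rw [hl₃' (v i) (by rcases h with rfl | rfl <;> simp), mul_zero]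
  · intro h
    have : i = 0 := e.injective (h.trans he0.symm)
    rw [this]
    exact mul_ne_zero (mul_ne_zero hl₁ hl₂) hl₃

/-- The components of `X(z) - z`, as polynomials. -/
noncomputable def fixPoly (T : Matrix (Fin 3) (Fin 6) ℂ) (j : Fin 3) : MvPolynomial (Fin 3) ℂ :=
  quadPoly (T j) - MvPolynomial.X j

theorem eval_fixPoly (T : Matrix (Fin 3) (Fin 6) ℂ) (j : Fin 3) (z : Fin 3 → ℂ) :
    MvPolynomial.eval z (fixPoly T j) = (T *ᵥ veronese z) j - z j := by
  rw [fixPoly, map_sub, eval_quadPoly, MvPolynomial.eval_X]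
  rfl

/-- Every cubic polynomial vanishing at eight simple fixed points is a combination of the
components of `X(z) - z` with affine coefficients. -/
theorem exists_affine_combination (hfin : {z | T *ᵥ veronese z = z}.Finite)
    (hP : ∀ k, T *ᵥ veronese (P k) = P k) (hinj : Function.Injective P) (h0 : P 0 = 0)
    (hsimple : ∀ k, (1 - T * dVeronese (P k)).det ≠ 0) {g : MvPolynomial (Fin 3) ℂ}
    (hg : g.totalDegree ≤ 3) (hgP : ∀ k, MvPolynomial.eval (P k) g = 0) :
    ∃ l : Fin 3 → Fin 4 → ℂ, ∀ z, MvPolynomial.eval z g =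
      ∑ j, (l j ⬝ᵥ Fin.cons 1 z) * ((T *ᵥ veronese z) j - z j) := by
  let E := MvPolynomial.restrictTotalDegree (Fin 3) ℂ 3
  have hfixdeg : ∀ j, (fixPoly T j).totalDegree ≤ 2 := fun j =>
    (MvPolynomial.totalDegree_sub _ _).trans
      (max_le (isHomogeneous_quadPoly _).totalDegree_le (by simp))
  let Φ : (Fin 3 → Fin 4 → ℂ) →ₗ[ℂ] E :=
    { toFun := fun l => ⟨∑ j, affPoly (l j) * fixPoly T j, by
        rw [MvPolynomial.mem_restrictTotalDegree]
        refine MvPolynomial.totalDegree_finsetSum_le fun j _ => ?_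
        refine (MvPolynomial.totalDegree_mul _ _).trans ?_
        have := totalDegree_affPoly_le (l j)
        have := hfixdeg j
        omega⟩
      map_add' := fun l m => by
        ext1
        simp only [Pi.add_apply, affPoly_add, add_mul, Finset.sum_add_distrib, Submodule.coe_add]
      map_smul' := fun c l => by
        ext1
        simp only [Pi.smul_apply, affPoly_smul, smul_mul_assoc, Finset.smul_sum, RingHom.id_apply,
          Submodule.coe_smul] }
  let ev : E →ₗ[ℂ] (Fin 8 → ℂ) :=
    (LinearMap.pi fun k => (MvPolynomial.aeval (P k) :
      MvPolynomial (Fin 3) ℂ →ₐ[ℂ] ℂ).toLinearMap) ∘ₗ E.subtype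
  have hev : ∀ (f : E) k, ev f k = MvPolynomial.eval (P k) (f : MvPolynomial (Fin 3) ℂ) := by
    intro f k
    exact congrFun (congrArg DFunLike.coe (MvPolynomial.coe_aeval_eq_eval (P k))) f.1
  -- At a fixed point the derivative of the combination is the vector of values of the `l j` times
  -- `M - 1`, which is invertible. So each `l j` vanishes at all eight points and is zero.
  have hΦinj : Function.Injective Φ := by
    rw [← LinearMap.ker_eq_bot, LinearMap.ker_eq_bot']
    intro l hl
    have hl' : ∑ j, affPoly (l j) * fixPoly T j = 0 := congrArg Subtype.val hl
    have hvan : ∀ k j, l j ⬝ᵥ Fin.cons 1 (P k) = 0 := by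
      intro k
      have hv : (fun j => l j ⬝ᵥ (Fin.cons 1 (P k) : Fin 4 → ℂ)) = 0 := by
        refine Matrix.eq_zero_of_vecMul_eq_zero (hsimple k) ?_
        ext m
        have h1 := congrArg (fun f => MvPolynomial.eval (P k) (MvPolynomial.pderiv m f)) hl'
        simp only [map_sum, Derivation.leibniz, map_add, smul_eq_mul, map_mul, map_zero,
          eval_fixPoly, hP, sub_self, zero_mul, add_zero, eval_affPoly] at h1
        simp only [Matrix.vecMul, dotProduct] at h1 ⊢
        rw [Pi.zero_apply, ← neg_eq_zero, ← Finset.sum_neg_distrib, ← h1]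
        refine Finset.sum_congr rfl fun j _ => ?_
        rw [fixPoly, map_sub, map_sub, eval_pderiv_quadPoly, MvPolynomial.pderiv_X, ← mul_neg]
        congr 1
        rw [Matrix.sub_apply, Matrix.mul_apply, neg_sub, Matrix.one_apply, Pi.single_apply]
        split_ifs <;> simp
      exact congrFun hv
    ext1 j
    exact eq_zero_of_affine_vanish hfin hP hinj h0 fun k => hvan k j
  have hsurj : Function.Surjective ev := by
    rw [← LinearMap.range_eq_top, eq_top_iff, ← (Pi.basisFun ℂ (Fin 8)).span_eq,
      Submodule.span_le]
    rintro _ ⟨k, rfl⟩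
    obtain ⟨l₁, l₂, l₃, hl⟩ := exists_three_affine hfin hP hinj h0 k
    let f : E := ⟨affPoly l₁ * affPoly l₂ * affPoly l₃, by
      rw [MvPolynomial.mem_restrictTotalDegree]
      have h1 := totalDegree_affPoly_le l₁
      have h2 := totalDegree_affPoly_le l₂
      have h3 := totalDegree_affPoly_le l₃
      have h4 := MvPolynomial.totalDegree_mul (affPoly l₁) (affPoly l₂)
      have h5 := MvPolynomial.totalDegree_mul (affPoly l₁ * affPoly l₂) (affPoly l₃)
      omega⟩
    have hf : ∀ j, ev f j ≠ 0 ↔ j = k := fun j => by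
      rw [hev]
      simp only [f, map_mul, eval_affPoly]
      exact hl j
    refine ⟨(ev f k)⁻¹ • f, ?_⟩
    ext j
    rw [map_smul, Pi.smul_apply, smul_eq_mul, Pi.basisFun_apply]
    by_cases hj : j = k
    · subst hj
      rw [Pi.single_eq_same, inv_mul_cancel₀ ((hf j).2 rfl)]
    · rw [Pi.single_eq_of_ne hj, not_not.1 (mt (hf j).1 hj), mul_zero]
  have hle : LinearMap.range Φ ≤ LinearMap.ker ev := by
    rintro _ ⟨l, rfl⟩
    rw [LinearMap.mem_ker]
    ext k
    rw [hev]
    simp [Φ, eval_fixPoly, hP]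
  have heq : LinearMap.range Φ = LinearMap.ker ev := by
    -- The count is `12 + 8 = 20`: the combinations have dimension 12, and the cubics vanishing at
    -- the eight points have dimension at most `20 - 8`.
    refine Submodule.eq_of_le_of_finrank_le hle ?_
    have h1 := ev.finrank_range_add_finrank_ker
    rw [LinearMap.range_eq_top.2 hsurj, finrank_top, Module.finrank_fin_fun] at h1
    have h2 := LinearMap.finrank_range_of_inj hΦinj
    have h3 : Module.finrank ℂ (Fin 3 → Fin 4 → ℂ) = 12 := by
      simp [Module.finrank_pi_fintype]
    have h4 : Module.finrank ℂ E ≤ 20 := finrank_restrictTotalDegree_three_le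
    omega
  have hgmem : (⟨g, (MvPolynomial.mem_restrictTotalDegree _ _ _).2 hg⟩ : E) ∈
      LinearMap.ker ev := by
    rw [LinearMap.mem_ker]
    ext k
    rw [hev]
    exact hgP k
  rw [← heq] at hgmem
  obtain ⟨l, hl⟩ := hgmem
  refine ⟨l, fun z => ?_⟩
  have hl' : ∑ j, affPoly (l j) * fixPoly T j = g := congrArg Subtype.val hl
  rw [← hl', map_sum]
  simp only [map_mul, eval_affPoly, eval_fixPoly]

end EightPoints

/-! ### Conics through six of the seven radial fixed points. -/

theorem eq_zero_of_cubic_vanish {a b c : ℂ} (h : ∀ s : ℂ, a * s + b * s ^ 2 + c * s ^ 3 = 0) :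
    a = 0 ∧ b = 0 ∧ c = 0 := by
  have h1 := h 1
  have h2 := h (-1)
  have h3 := h 2
  refine ⟨?_, ?_, ?_⟩
  · linear_combination h1 - h2 / 3 - h3 / 6
  · linear_combination h1 / 2 + h2 / 2
  · linear_combination -h1 / 2 - h2 / 6 + h3 / 6

/-- Six of seven simple radial fixed points do not lie on a conic. -/
theorem eq_zero_of_conic {T : Matrix (Fin 3) (Fin 6) ℂ}
    (hfin : {z | T *ᵥ veronese z = z}.Finite) {p : Fin 7 → Fin 3 → ℂ}
    (hp : ∀ k, T *ᵥ veronese (p k) = p k) (hinj : Function.Injective p) (hp0 : ∀ k, p k ≠ 0)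
    (hsimple : ∀ k, (1 - T * dVeronese (p k)).det ≠ 0) (m : Fin 7) {c : Fin 6 → ℂ}
    (hc : ∀ k, k ≠ m → c ⬝ᵥ veronese (p k) = 0) : c = 0 := by
  -- From a conic through the six points other than `p m` it will follow that these six lie in a
  -- plane through the origin, which is excluded already for four of them.
  by_contra hc0
  let P : Fin 8 → Fin 3 → ℂ := Fin.cons 0 p
  have hPfix : ∀ k, T *ᵥ veronese (P k) = P k := fun k => by
    refine Fin.cases ?_ (fun k => ?_) k
    · simp [P, veronese_zero]
    · simpa [P] using hp k
  have hPinj : Function.Injective P :=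
    Fin.cons_injective_iff.2 ⟨fun ⟨k, hk⟩ => hp0 k hk, hinj⟩
  have hPsimple : ∀ k, (1 - T * dVeronese (P k)).det ≠ 0 := fun k => by
    refine Fin.cases ?_ (fun k => ?_) k
    · have : dVeronese (P 0) = 0 := by
        ext J j
        simp [P, dVeronese]
      simp [this]
    · simpa [P] using hsimple k
  -- The conic times `z i - p m i` is a cubic vanishing at all eight points: the conic takes care of
  -- the origin and of the six points, the affine factor of `p m`.
  have hdeg : ∀ i, ((MvPolynomial.X i - MvPolynomial.C (p m i)) * quadPoly c).totalDegree ≤ 3 := by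
    intro i
    refine (MvPolynomial.totalDegree_mul _ _).trans ?_
    have h1 : (MvPolynomial.X i - MvPolynomial.C (p m i) :
        MvPolynomial (Fin 3) ℂ).totalDegree ≤ 1 :=
      (MvPolynomial.totalDegree_sub _ _).trans (max_le (by simp) (by simp))
    have h2 := (isHomogeneous_quadPoly c).totalDegree_le
    omega
  have hvan : ∀ i k, MvPolynomial.eval (P k)
      ((MvPolynomial.X i - MvPolynomial.C (p m i)) * quadPoly c) = 0 := by
    intro i k
    rw [map_mul, eval_quadPoly]
    refine Fin.cases ?_ (fun k => ?_) k
    · simp [P, veronese_zero]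
    · by_cases hk : k = m
      · simp [P, hk]
      · simp [P, hc k hk]
  choose l hl using fun i => exists_affine_combination hfin hPfix hPinj rfl hPsimple (hdeg i) (hvan i)
  -- separate the homogeneous components
  let A : Fin 3 → Matrix (Fin 3) (Fin 3) ℂ := fun i => Matrix.of fun j k => l i j k.succ
  have hcomp : ∀ i z, (∑ j, l i j 0 * z j = 0) ∧
      ((A i *ᵥ z) ⬝ᵥ z - ∑ j, l i j 0 * (T *ᵥ veronese z) j = p m i * (c ⬝ᵥ veronese z)) ∧
      (A i *ᵥ z) ⬝ᵥ (T *ᵥ veronese z) = z i * (c ⬝ᵥ veronese z) := by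
    intro i z
    have hAff : ∀ j (w : Fin 3 → ℂ), l i j ⬝ᵥ Fin.cons 1 w = l i j 0 + (A i *ᵥ w) j := by
      intro j w
      simp [A, dotProduct, Fin.sum_univ_succ, Matrix.mulVec]
    have key : ∀ s : ℂ, (∑ j, l i j 0 * z j) * s +
        ((A i *ᵥ z) ⬝ᵥ z - ∑ j, l i j 0 * (T *ᵥ veronese z) j - p m i * (c ⬝ᵥ veronese z)) * s ^ 2 +
        (z i * (c ⬝ᵥ veronese z) - (A i *ᵥ z) ⬝ᵥ (T *ᵥ veronese z)) * s ^ 3 = 0 := by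
      intro s
      have h := hl i (s • z)
      rw [map_mul, eval_quadPoly] at h
      simp only [hAff, veronese_smul, mulVec_smul, dotProduct_smul, Pi.smul_apply, smul_eq_mul,
        map_sub, MvPolynomial.eval_X, MvPolynomial.eval_C] at h
      simp only [dotProduct, Fin.sum_univ_three] at h ⊢
      linear_combination h
    obtain ⟨h1, h2, h3⟩ := eq_zero_of_cubic_vanish key
    exact ⟨h1, sub_eq_zero.1 h2, (sub_eq_zero.1 h3).symm⟩
  have hconst : ∀ i j, l i j 0 = 0 := by
    intro i j
    have := (hcomp i (Pi.single j 1)).1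
    simpa [Pi.single_apply] using this
  have hA1 : ∀ i z, (A i *ᵥ z) ⬝ᵥ z = p m i * (c ⬝ᵥ veronese z) := by
    intro i z
    have := (hcomp i z).2.1
    simpa [hconst] using this
  -- combinations adapted to a vector
  let B : (Fin 3 → ℂ) → Matrix (Fin 3) (Fin 3) ℂ := fun r => ∑ i, r i • A i
  have hBmul : ∀ r z w, (B r *ᵥ z) ⬝ᵥ w = ∑ i, r i * ((A i *ᵥ z) ⬝ᵥ w) := by
    intro r z w
    simp [B, Matrix.sum_mulVec, Matrix.smul_mulVec, sum_dotProduct, smul_dotProduct]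
  have hB1 : ∀ r z, (B r *ᵥ z) ⬝ᵥ z = (r ⬝ᵥ p m) * (c ⬝ᵥ veronese z) := by
    intro r z
    rw [hBmul, dotProduct, Finset.sum_mul]
    exact Finset.sum_congr rfl fun i _ => by rw [hA1]; ring
  have hB2 : ∀ r z, (B r *ᵥ z) ⬝ᵥ (T *ᵥ veronese z) = (r ⬝ᵥ z) * (c ⬝ᵥ veronese z) := by
    intro r z
    rw [hBmul, dotProduct, Finset.sum_mul]
    exact Finset.sum_congr rfl fun i _ => by rw [(hcomp _ z).2.2]; ring
  let U : Matrix (Fin 3) (Fin 3) ℂ := Matrix.of fun i => ![A i 2 1, A i 0 2, A i 1 0]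
  -- For `r` orthogonal to `p m` the matrix `B r` will be antisymmetric, the cross product with `u =
  -- r ᵥ* U`. As `r` varies in the plane orthogonal to `p m`, these `u` stay in a plane, with normal
  -- `w`.
  obtain ⟨w, hw0, hw⟩ : ∃ w : Fin 3 → ℂ, w ≠ 0 ∧ ∀ r, r ⬝ᵥ p m = 0 → r ⬝ᵥ (U *ᵥ w) = 0 := by
    by_cases hU : U.det = 0
    · obtain ⟨w, hw0, hw⟩ := Matrix.exists_mulVec_eq_zero_iff.2 hU
      exact ⟨w, hw0, fun r _ => by rw [hw, dotProduct_zero]⟩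
    · refine ⟨U⁻¹ *ᵥ p m, fun h => hp0 m ?_, fun r hr => ?_⟩
      · have := congrArg (U *ᵥ ·) h
        simpa [Matrix.mulVec_mulVec, Matrix.mul_nonsing_inv _ (isUnit_iff_ne_zero.2 hU)] using this
      · rw [Matrix.mulVec_mulVec, Matrix.mul_nonsing_inv _ (isUnit_iff_ne_zero.2 hU),
          Matrix.one_mulVec, hr]
  have hplane : ∀ k, k ≠ m → p k ⬝ᵥ w = 0 := by
    intro k hk
    -- This choice is orthogonal to both `p m` and `p k`. It will give `B r *ᵥ p k = 0`, so that `p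
    -- k` is parallel to `u` and lies in the plane with normal `w`.
    let r : Fin 3 → ℂ := crossProduct (p k) (p m)
    have hrm : r ⬝ᵥ p m = 0 := by
      rw [dotProduct_comm]; exact dot_cross_self _ _
    have hrk : r ⬝ᵥ p k = 0 := by
      rw [dotProduct_comm]; exact dot_self_cross _ _
    have hr0 : r ≠ 0 := by
      refine crossProduct_ne_zero_iff_linearIndependent.2 (LinearIndependent.pair_iff.2 ?_)
      intro x y h
      exact eq_zero_of_smul_add_smul_eq_zero (hp k) (hp m) (hp0 k) (hp0 m) (hinj.ne hk) h
    have hanti : ∀ z v, (B r *ᵥ z) ⬝ᵥ v + (B r *ᵥ v) ⬝ᵥ z = 0 := by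
      intro z v
      have h1 := hB1 r (z + v)
      have h2 := hB1 r z
      have h3 := hB1 r v
      rw [hrm, zero_mul] at h1 h2 h3
      rw [mulVec_add, add_dotProduct, dotProduct_add, dotProduct_add] at h1
      linear_combination h1 - h2 - h3
    -- Both factors on the right of `hB2` vanish at `p k`, so the first-order term of the left side
    -- along `v` is zero. With antisymmetry this says that `B r *ᵥ p k` is orthogonal to the image
    -- of `1 - M`, which is everything.
    have hBp : B r *ᵥ p k = 0 := by
      refine Matrix.eq_zero_of_vecMul_eq_zero (hsimple k) ?_
      have hv : ∀ v, (B r *ᵥ p k) ⬝ᵥ ((1 - T * dVeronese (p k)) *ᵥ v) = 0 := by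
        intro v
        obtain ⟨h1, -, -⟩ := eq_zero_of_cubic_vanish
          (a := (B r *ᵥ v) ⬝ᵥ p k + (B r *ᵥ p k) ⬝ᵥ ((T * dVeronese (p k)) *ᵥ v))
          (b := (B r *ᵥ v) ⬝ᵥ ((T * dVeronese (p k)) *ᵥ v) +
            (B r *ᵥ p k) ⬝ᵥ (T *ᵥ veronese v) -
            (r ⬝ᵥ v) * (c ⬝ᵥ (dVeronese (p k) *ᵥ v)))
          (c := (B r *ᵥ v) ⬝ᵥ (T *ᵥ veronese v) - (r ⬝ᵥ v) * (c ⬝ᵥ veronese v)) (by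
            intro s
            have h := hB2 r (p k + s • v)
            have h0 := hB2 r (p k)
            rw [mulVec_veronese_add, hp k, veronese_add, veronese_smul] at h
            rw [hp k, hrk, zero_mul] at h0
            simp only [mulVec_add, mulVec_smul, add_dotProduct, dotProduct_add, smul_dotProduct,
              dotProduct_smul, smul_eq_mul, hrk, hc k hk, h0, zero_add] at h
            linear_combination h)
        have h2 := hanti (p k) v
        rw [Matrix.sub_mulVec, Matrix.one_mulVec, dotProduct_sub]
        linear_combination h2 - h1
      ext j
      have := hv (Pi.single j 1)
      rwa [Matrix.dotProduct_mulVec, dotProduct_single_one] at this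
    -- `B r` is the cross product with `u`
    let u : Fin 3 → ℂ := ![B r 2 1, B r 0 2, B r 1 0]
    have hent : ∀ a b, B r a b + B r b a = 0 := by
      intro a b
      have := hanti (Pi.single b 1) (Pi.single a 1)
      simpa using this
    have hcross : ∀ z, B r *ᵥ z = crossProduct u z := by
      intro z
      have h00 := hent 0 0
      have h11 := hent 1 1
      have h22 := hent 2 2
      have h01 := hent 0 1
      have h02 := hent 0 2
      have h12 := hent 1 2
      rw [cross_apply]
      ext a
      fin_cases a <;> simp [Matrix.mulVec, dotProduct, Fin.sum_univ_three, u]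
      · linear_combination z 0 * h00 / 2 + z 1 * h01
      · linear_combination z 1 * h11 / 2 + z 2 * h12
      · linear_combination z 2 * h22 / 2 + z 0 * h02
    -- Otherwise `hB2` says that the product of the linear form `r` and the conic is identically
    -- zero.
    have hu0 : u ≠ 0 := by
      intro hu
      have hprod : (∑ i, MvPolynomial.C (r i) * MvPolynomial.X i) * quadPoly c = 0 := by
        apply MvPolynomial.funext
        intro z
        have := hB2 r z
        rw [hcross, hu, map_zero, LinearMap.zero_apply, zero_dotProduct] at this
        rw [map_mul, eval_quadPoly, map_zero, map_sum, this]
        simp [dotProduct]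
      rcases mul_eq_zero.1 hprod with h | h
      · apply hr0
        ext i
        have := congrArg (MvPolynomial.eval (Pi.single i 1)) h
        simpa [Pi.single_apply] using this
      · apply hc0
        ext J
        rw [← coeff_quadPoly c J, h, MvPolynomial.coeff_zero]
        rfl
    have hwu : u ⬝ᵥ w = 0 := by
      have h1 : u = r ᵥ* U := by
        ext a
        fin_cases a <;> simp [u, U, B, Matrix.vecMul, dotProduct, Fin.sum_univ_three]
      rw [h1, ← Matrix.dotProduct_mulVec]
      exact hw r hrm
    have hup : crossProduct u (p k) = 0 := by rw [← hcross, hBp]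
    obtain ⟨a, ha⟩ : ∃ a, u a ≠ 0 := by
      by_contra! h
      exact hu0 (funext h)
    have hpar : ∀ b, u a * p k b = p k a * u b := by
      rw [cross_apply] at hup
      have e0 := congrFun hup 0
      have e1 := congrFun hup 1
      have e2 := congrFun hup 2
      simp at e0 e1 e2
      intro b
      fin_cases a <;> fin_cases b <;> simp <;> first
        | ring1
        | linear_combination e0
        | linear_combination -e0
        | linear_combination e1
        | linear_combination -e1
        | linear_combination e2
        | linear_combination -e2
    have : u a * (p k ⬝ᵥ w) = p k a * (u ⬝ᵥ w) := by
      simp only [dotProduct, Finset.mul_sum, ← mul_assoc, hpar]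
    rw [hwu, mul_zero] at this
    exact (mul_eq_zero.1 this).resolve_left ha
  apply hw0
  refine eq_zero_of_four_fixed hfin (p := fun k : Fin 4 => p (m.succAbove (k.castLE (by norm_num))))
    (fun k => hp _) (fun k => hp0 _) (fun a b h => ?_) fun k => hplane _ (Fin.succAbove_ne _ _)
  exact Fin.castLE_injective _ (Fin.succAbove_right_injective (hinj h))

/-- The Veronese matrix of six points. -/
def veroneseMatrix {S : Type} [CommRing S] (y : Fin 6 → Fin 3 → S) : Matrix (Fin 6) (Fin 6) S :=
  Matrix.of fun k => veronese (y k)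

/-- A kernel vector would be a conic through six of the seven points. Thus any six of them, in any
order, give a complex point of `ConfRing`. -/
theorem det_veroneseMatrix_ne_zero {T : Matrix (Fin 3) (Fin 6) ℂ}
    (hfin : {z | T *ᵥ veronese z = z}.Finite) {p : Fin 7 → Fin 3 → ℂ}
    (hp : ∀ k, T *ᵥ veronese (p k) = p k) (hinj : Function.Injective p) (hp0 : ∀ k, p k ≠ 0)
    (hsimple : ∀ k, (1 - T * dVeronese (p k)).det ≠ 0) (σ : Fin 6 ↪ Fin 7) :
    (veroneseMatrix (p ∘ σ)).det ≠ 0 := by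
  intro hdet
  obtain ⟨c, hc0, hc⟩ := Matrix.exists_mulVec_eq_zero_iff.2 hdet
  obtain ⟨m, hm⟩ : ∃ m, m ∉ Set.range σ := by
    by_contra! h
    have := Fintype.card_le_of_surjective σ h
    simp at this
  refine hc0 (eq_zero_of_conic hfin hp hinj hp0 hsimple m fun k hk => ?_)
  obtain ⟨j, rfl⟩ : k ∈ Set.range σ := by
    by_contra hk'
    have hss : ({k, m} : Finset (Fin 7)) ⊆ (Finset.univ.image σ)ᶜ := by
      intro x hx
      rw [Finset.mem_compl, Finset.mem_image]
      rintro ⟨j, -, rfl⟩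
      simp only [Finset.mem_insert, Finset.mem_singleton] at hx
      rcases hx with h | h
      · exact hk' ⟨j, h⟩
      · exact hm ⟨j, h⟩
    have h1 := Finset.card_le_card hss
    rw [Finset.card_compl, Finset.card_image_of_injective _ σ.injective, Finset.card_pair hk] at h1
    simp at h1
  rw [dotProduct_comm]
  exact congrFun hc j

/-! ### The linearized problem and its injectivity at one explicit field. -/

section Linearization

variable {S : Type} [CommRing S]

theorem dVeronese_add (z w : Fin 3 → S) : dVeronese (z + w) = dVeronese z + dVeronese w := by
  ext J j
  simp only [dVeronese, Matrix.of_apply, Matrix.add_apply, Pi.add_apply]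
  split_ifs <;> ring

/-- The derivative of the Jacobian matrix `T * dVeronese z`. -/
def jacVariation (T dT : Matrix (Fin 3) (Fin 6) S) (z dz : Fin 3 → S) : Matrix (Fin 3) (Fin 3) S :=
  dT * dVeronese z + T * dVeronese dz

theorem jacVariation_add (T dT dT' : Matrix (Fin 3) (Fin 6) S) (z dz dz' : Fin 3 → S) :
    jacVariation T (dT + dT') z (dz + dz') = jacVariation T dT z dz + jacVariation T dT' z dz' := by
  simp only [jacVariation, dVeronese_add, Matrix.add_mul, Matrix.mul_add]
  abel

theorem jacVariation_smul (c : S) (T dT : Matrix (Fin 3) (Fin 6) S) (z dz : Fin 3 → S) :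
    jacVariation T (c • dT) z (c • dz) = c • jacVariation T dT z dz := by
  simp only [jacVariation, dVeronese_smul, Matrix.smul_mul, Matrix.mul_smul, smul_add]

/-- The infinitesimal variations of a vector field and of six of its fixed points. -/
abbrev VarIdx : Type := (Fin 3 × Fin 6) ⊕ (Fin 6 × Fin 3)

/-- The linear conditions on infinitesimal variations. -/
abbrev CondIdx : Type := (Fin 6 × Fin 3) ⊕ (Fin 3 × Fin 3) ⊕ Fin 6 ⊕ Fin 3

/-- The first three of six indices. -/
def firstThree : Fin 3 → Fin 6 := Fin.castLE (by norm_num)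

/-- The variation of the vector field. -/
def varField (u : VarIdx → S) : Matrix (Fin 3) (Fin 6) S := Matrix.of fun i J => u (.inl (i, J))

/-- The variation of the points. -/
def varPoint (u : VarIdx → S) (k : Fin 6) : Fin 3 → S := fun i => u (.inr (k, i))

theorem varField_add (u v : VarIdx → S) : varField (u + v) = varField u + varField v := rfl

theorem varPoint_add (u v : VarIdx → S) (k : Fin 6) :
    varPoint (u + v) k = varPoint u k + varPoint v k := rfl

theorem varField_smul (c : S) (u : VarIdx → S) : varField (c • u) = c • varField u := rfl

theorem varPoint_smul (c : S) (u : VarIdx → S) (k : Fin 6) :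
    varPoint (c • u) k = c • varPoint u k := rfl

/-- The linearization of the conditions that six points are fixed, that the first three of them do
not move, that the traces of the Jacobian matrices at the six points are constant and that the
determinants of `1 - M` at the first three points are constant. -/
def linearization (T : Matrix (Fin 3) (Fin 6) S) (p : Fin 6 → Fin 3 → S) :
    (VarIdx → S) →ₗ[S] (CondIdx → S) where
  toFun u := Sum.elim
    (fun q => (varField u *ᵥ veronese (p q.1) +
      (T * dVeronese (p q.1)) *ᵥ varPoint u q.1 - varPoint u q.1) q.2)
    (Sum.elim (fun q => varPoint u (firstThree q.1) q.2)
    (Sum.elim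
      (fun k => (jacVariation T (varField u) (p k) (varPoint u k)).trace)
      (fun k => (adjugate (1 - T * dVeronese (p (firstThree k))) *
        jacVariation T (varField u) (p (firstThree k)) (varPoint u (firstThree k))).trace)))
  map_add' u v := by
    ext r
    rcases r with r | r | r | r <;>
      simp only [varField_add, varPoint_add, Sum.elim_inl, Sum.elim_inr, Pi.add_apply,
        jacVariation_add, Matrix.add_mulVec, Matrix.mulVec_add, Matrix.mul_add, Matrix.trace_add,
        Pi.sub_apply]
    ring
  map_smul' c u := by
    ext r
    rcases r with r | r | r | r <;>
      simp only [varField_smul, varPoint_smul, Sum.elim_inl, Sum.elim_inr, Pi.add_apply,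
        jacVariation_smul, Matrix.smul_mulVec, Matrix.mulVec_smul, Matrix.mul_smul,
        Matrix.trace_smul, Pi.sub_apply, Pi.smul_apply, RingHom.id_apply, smul_eq_mul]
    ring

end Linearization

/-- Six fixed points of the field `x(x+2z), y(y+2x), z(z+2y)`. -/
def basePoints : Fin 6 → Fin 3 → ℂ :=
  ![![1, 0, 0], ![0, 1, 0], ![0, 0, 1], ![0, 1, -1], ![-1, 0, 1], ![1, -1, 0]]

/-- The coefficients of the field `x(x+2z), y(y+2x), z(z+2y)`. -/
def baseField : Matrix (Fin 3) (Fin 6) ℂ :=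
  !![1, 0, 0, 0, 2, 0; 0, 1, 0, 0, 0, 2; 0, 0, 1, 2, 0, 0]

theorem baseField_mulVec_veronese (k : Fin 6) :
    baseField *ᵥ veronese (basePoints k) = basePoints k := by
  ext i
  fin_cases k <;> fin_cases i <;>
    simp [baseField, basePoints, veronese, quadIdx, Matrix.mulVec, dotProduct, Fin.sum_univ_six] <;>
    norm_num

theorem dVeronese_eq {S : Type} [CommRing S] (z : Fin 3 → S) : dVeronese z =
    !![2 * z 0, 0, 0; 0, 2 * z 1, 0; 0, 0, 2 * z 2; 0, z 2, z 1; z 2, 0, z 0; z 1, z 0, 0] := by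
  ext J j
  fin_cases J <;> fin_cases j <;> simp [dVeronese, quadIdx, two_mul]

/-- The matrices `1 - M` of the base field at its first three base points. -/
def baseMatrix : Fin 3 → Matrix (Fin 3) (Fin 3) ℂ :=
  ![!![-1, 0, -2; 0, -1, 0; 0, 0, 1], !![1, 0, 0; -2, -1, 0; 0, 0, -1],
    !![-1, 0, 0; 0, 1, 0; 0, -2, -1]]

theorem one_sub_baseField_mul (k : Fin 3) :
    1 - baseField * dVeronese (basePoints (firstThree k)) = baseMatrix k := by
  rw [dVeronese_eq]
  ext i j
  fin_cases k <;> fin_cases i <;> fin_cases j <;>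
    simp [baseField, basePoints, firstThree, baseMatrix] <;>
    norm_num

/-- Each of these matrices is an involution of determinant 1. -/
theorem adjugate_baseMatrix (k : Fin 3) : adjugate (baseMatrix k) = baseMatrix k := by
  fin_cases k <;> simp [baseMatrix, adjugate_fin_three]

/-- The only explicit computation behind finiteness. There are `18 + 18` unknowns and `18 + 9 + 6 +
3` equations, so the system is square. Since the first three points are the coordinate vectors and
do not move, the variations of the coefficients of the squares vanish at once, and the other
equations are sparse. -/
theorem eq_zero_of_linearization_base (u : VarIdx → ℂ)
    (h : linearization baseField basePoints u = 0) : u = 0 := by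
  have e0 : ∀ k i, linearization baseField basePoints u (.inl (k, i)) = 0 := fun k i => by
    rw [h]; rfl
  have e1 : ∀ k i, linearization baseField basePoints u (.inr (.inl (k, i))) = 0 := fun k i => by
    rw [h]; rfl
  have e2 : ∀ k, linearization baseField basePoints u (.inr (.inr (.inl k))) = 0 := fun k => by
    rw [h]; rfl
  have e3 : ∀ k, linearization baseField basePoints u (.inr (.inr (.inr k))) = 0 := fun k => by
    rw [h]; rfl
  have htr : ∀ A B : Matrix (Fin 3) (Fin 3) ℂ, (A * B).trace = ∑ i, ∑ j, A i j * B j i :=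
    fun A B => by simp only [Matrix.trace, Matrix.diag_apply, Matrix.mul_apply]
  simp only [linearization, LinearMap.coe_mk, AddHom.coe_mk, Sum.elim_inl, Sum.elim_inr] at e0 e1 e2
  simp only [linearization, LinearMap.coe_mk, AddHom.coe_mk, Sum.elim_inr,
    one_sub_baseField_mul, adjugate_baseMatrix, htr] at e3
  simp only [Pi.sub_apply, Pi.add_apply, Matrix.mulVec, dotProduct] at e0
  simp only [Fin.sum_univ_three, jacVariation, Matrix.add_apply, Matrix.mul_apply,
    Fin.sum_univ_six, Matrix.trace_fin_three, Fin.forall_fin_succ,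
    IsEmpty.forall_iff, and_true, dVeronese_eq] at e0 e1 e2 e3
  simp [varPoint, firstThree] at e1
  simp [varField, varPoint, baseField, basePoints, veronese, quadIdx, e1] at e0
  simp [varField, varPoint, baseField, basePoints, e0, e1] at e2
  simp [varField, varPoint, baseField, basePoints, firstThree, baseMatrix, e0, e1] at e3
  clear h htr
  obtain ⟨⟨p00, p01, p02⟩, ⟨p10, p11, p12⟩, p20, p21, p22⟩ := e1
  obtain ⟨⟨t00, t10, t20⟩, ⟨t01, t11, t21⟩, ⟨t02, t12, t22⟩, ⟨a30, a31, a32⟩, ⟨a40, a41, a42⟩,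
    a50, a51, a52⟩ := e0
  obtain ⟨s0, s1, s2, s3, s4, s5⟩ := e2
  obtain ⟨d0, d1, d2⟩ := e3
  ext q
  rcases q with ⟨i, J⟩ | ⟨k, i⟩
  · fin_cases i <;> fin_cases J <;> simp <;> grind
  · fin_cases k <;> fin_cases i <;> simp <;> grind

/-! ### Compatibility with derivations and ring homomorphisms. -/

section DerivationOfMatrices

variable {k A K : Type} [CommRing k] [CommRing A] [Algebra k A] [CommRing K] [Algebra A K]
  [Algebra k K] (D : Derivation k A K)

theorem Derivation.map_matrix_mulVec {m n : Type} [Fintype n] (T : Matrix m n A) (v : n → A)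
    (i : m) : D ((T *ᵥ v) i) =
      (T.map D *ᵥ fun j => algebraMap A K (v j)) i +
        (T.map (algebraMap A K) *ᵥ fun j => D (v j)) i := by
  simp only [Matrix.mulVec, dotProduct, map_sum, Derivation.leibniz, Matrix.map_apply,
    Algebra.smul_def, Finset.sum_add_distrib]
  rw [add_comm]
  congr 1
  exact Finset.sum_congr rfl fun j _ => mul_comm _ _

theorem Derivation.map_matrix_mul {m n l : Type} [Fintype n] (T : Matrix m n A)
    (U : Matrix n l A) : (T * U).map D =
      T.map D * U.map (algebraMap A K) + T.map (algebraMap A K) * U.map D := by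
  ext i j
  exact D.map_matrix_mulVec T (fun k => U k j) i

theorem Derivation.map_veronese (z : Fin 3 → A) (J : Fin 6) :
    D (veronese z J) =
      (dVeronese (fun i => algebraMap A K (z i)) *ᵥ fun i => D (z i)) J := by
  rw [dVeronese_mulVec]
  simp only [veronese, Derivation.leibniz, Algebra.smul_def]
  ring

theorem Derivation.map_dVeronese (z : Fin 3 → A) :
    (dVeronese z).map D = dVeronese fun i => D (z i) := by
  ext J j
  simp only [dVeronese, Matrix.map_apply, Matrix.of_apply, map_add]
  congr 1 <;> split_ifs <;> simp

/-- Jacobi's formula; it is why the adjugate occurs in `linearization`. -/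
theorem Derivation.map_det_fin_three (N : Matrix (Fin 3) (Fin 3) A) :
    D N.det = (adjugate (N.map (algebraMap A K)) * N.map D).trace := by
  rw [Matrix.det_fin_three, Matrix.adjugate_fin_three]
  simp only [map_add, map_sub, Derivation.leibniz, Algebra.smul_def, Matrix.trace_fin_three,
    Matrix.mul_apply, Fin.sum_univ_three, Matrix.map_apply, map_mul]
  simp
  ring

end DerivationOfMatrices

section Map

variable {A B : Type} [CommRing A] [CommRing B] (φ : A →+* B)

theorem map_dVeronese (z : Fin 3 → A) : (dVeronese z).map φ = dVeronese fun i => φ (z i) := by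
  ext J j
  exact dVeronese_map φ z J j

theorem linearization_map (T : Matrix (Fin 3) (Fin 6) A) (p : Fin 6 → Fin 3 → A) (u : VarIdx → A)
    (r : CondIdx) : φ (linearization T p u r) =
      linearization (T.map φ) (fun k i => φ (p k i)) (fun v => φ (u v)) r := by
  have hF : (varField fun v => φ (u v)) = (varField u).map φ := rfl
  have hP : ∀ k, (varPoint fun v => φ (u v)) k = fun i => φ (varPoint u k i) := fun k => rfl
  have hJ : ∀ k, jacVariation (T.map φ) ((varField u).map φ) (fun i => φ (p k i))
      (fun i => φ (varPoint u k i)) = (jacVariation T (varField u) (p k) (varPoint u k)).map φ := by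
    intro k
    simp only [jacVariation, ← map_dVeronese, ← Matrix.map_mul]
    exact (Matrix.map_add φ (map_add φ) _ _).symm
  have hM : ∀ k, 1 - T.map φ * dVeronese (fun i => φ (p k i)) =
      (1 - T * dVeronese (p k)).map φ := by
    intro k
    rw [← map_dVeronese, ← Matrix.map_mul, Matrix.map_sub φ (map_sub φ),
      Matrix.map_one φ (map_zero φ) (map_one φ)]
  have hv : ∀ k, (veronese fun i => φ (p k i)) = φ ∘ veronese (p k) := by
    intro k
    ext J
    exact (veronese_map φ (p k) J).symm
  have htr : ∀ N : Matrix (Fin 3) (Fin 3) A, (N.map φ).trace = φ N.trace := fun N => by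
    simp [Matrix.trace]
  rcases r with ⟨k, i⟩ | ⟨k, i⟩ | k | k
  · simp only [linearization, LinearMap.coe_mk, AddHom.coe_mk, Sum.elim_inl, hF, hP, hv,
      Pi.sub_apply, Pi.add_apply, map_sub, map_add, ← map_dVeronese, ← Matrix.map_mul]
    rw [RingHom.map_mulVec, RingHom.map_mulVec]
    rfl
  · rfl
  · simp only [linearization, LinearMap.coe_mk, AddHom.coe_mk, Sum.elim_inl, Sum.elim_inr, hF, hP,
      hJ, htr]
  · simp only [linearization, LinearMap.coe_mk, AddHom.coe_mk, Sum.elim_inr, hF, hP, hJ, hM]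
    rw [← htr, Matrix.map_mul]
    congr 2
    exact RingHom.map_adjugate φ _

end Map

/-! ### The generic configuration of six points and the field that it determines. -/

/-- The points of the generic configuration of six points of `ℂ^3`. -/
noncomputable def confVar (k : Fin 6) (i : Fin 3) : MvPolynomial (Fin 6 × Fin 3) ℂ :=
  MvPolynomial.X (k, i)

/-- The condition that the six points do not lie on a conic. -/
noncomputable def confDet : MvPolynomial (Fin 6 × Fin 3) ℂ := (veroneseMatrix confVar).det

theorem veroneseMatrix_map {A B : Type} [CommRing A] [CommRing B] (φ : A →+* B)
    (y : Fin 6 → Fin 3 → A) :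
    (veroneseMatrix y).map φ = veroneseMatrix fun k i => φ (y k i) := by
  ext k J
  exact veronese_map φ (y k) J

theorem aeval_confDet {A : Type} [CommRing A] [Algebra ℂ A] (y : Fin 6 → Fin 3 → A) :
    MvPolynomial.aeval (fun q : Fin 6 × Fin 3 => y q.1 q.2) confDet = (veroneseMatrix y).det := by
  rw [confDet, AlgHom.map_det, AlgHom.mapMatrix_apply]
  congr 1
  refine (veroneseMatrix_map
    (MvPolynomial.aeval fun q : Fin 6 × Fin 3 => y q.1 q.2).toRingHom confVar).trans ?_
  congr
  ext k i
  simp [confVar]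

theorem det_veroneseMatrix_basePoints : (veroneseMatrix basePoints).det ≠ 0 := by
  intro h
  obtain ⟨v, hv, hv0⟩ := Matrix.exists_mulVec_eq_zero_iff.mpr h
  have e : ∀ k, (veroneseMatrix basePoints *ᵥ v) k = 0 := fun k => by rw [hv0]; rfl
  simp only [Matrix.mulVec, dotProduct, Fin.sum_univ_six, Fin.forall_fin_succ] at e
  simp [veroneseMatrix, veronese, quadIdx, basePoints] at e
  apply hv
  ext J
  fin_cases J <;> simp <;> grind

theorem confDet_ne_zero : confDet ≠ 0 := by
  intro h
  apply det_veroneseMatrix_basePoints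
  rw [← aeval_confDet, h, map_zero]

/-- The ring of regular functions on the configurations of six points not lying on a conic. -/
abbrev ConfRing : Type := Localization.Away confDet

instance : IsDomain ConfRing :=
  IsLocalization.isDomain_localization
    (powers_le_nonZeroDivisors_of_noZeroDivisors confDet_ne_zero)

instance : Algebra.FiniteType ℂ ConfRing :=
  haveI : Algebra.FinitePresentation (MvPolynomial (Fin 6 × Fin 3) ℂ) ConfRing :=
    IsLocalization.Away.finitePresentation confDet
  Algebra.FiniteType.trans (S := MvPolynomial (Fin 6 × Fin 3) ℂ) inferInstance inferInstance

/-- The points of the generic configuration of six points not lying on a conic. -/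
noncomputable def confPoint (k : Fin 6) (i : Fin 3) : ConfRing :=
  algebraMap (MvPolynomial (Fin 6 × Fin 3) ℂ) ConfRing (confVar k i)

theorem isUnit_det_confPoint : IsUnit (veroneseMatrix confPoint).det := by
  have h : (veroneseMatrix confPoint).det = algebraMap _ ConfRing confDet := by
    refine Eq.trans ?_ (RingHom.map_det (algebraMap _ ConfRing) (veroneseMatrix confVar)).symm
    rw [RingHom.mapMatrix_apply, veroneseMatrix_map]
    rfl
  rw [h]
  exact IsLocalization.Away.algebraMap_isUnit confDet

/-- The Veronese vectors of six points not on a conic form a basis, on which a coefficient matrix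
can be read off. -/
theorem eq_of_mulVec_veronese_eq {S : Type} [CommRing S] {y : Fin 6 → Fin 3 → S}
    (hy : IsUnit (veroneseMatrix y).det) {T T' : Matrix (Fin 3) (Fin 6) S}
    (h : ∀ k, T *ᵥ veronese (y k) = T' *ᵥ veronese (y k)) : T = T' := by
  have h' : T * (veroneseMatrix y)ᵀ = T' * (veroneseMatrix y)ᵀ := by
    ext i k
    exact congrFun (h k) i
  have hu : IsUnit (veroneseMatrix y)ᵀ.det := by rwa [Matrix.det_transpose]
  have := congrArg (· * (veroneseMatrix y)ᵀ⁻¹) h'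
  simpa only [Matrix.mul_assoc, Matrix.mul_nonsing_inv _ hu, Matrix.mul_one] using this

/-- The vector field of which the points of the generic configuration are fixed points. -/
noncomputable def confField : Matrix (Fin 3) (Fin 6) ConfRing :=
  (Matrix.of fun i k => confPoint k i) * (veroneseMatrix confPoint)ᵀ⁻¹

theorem confField_mulVec_veronese (k : Fin 6) :
    confField *ᵥ veronese (confPoint k) = confPoint k := by
  have hu : IsUnit (veroneseMatrix confPoint)ᵀ.det := by
    rw [Matrix.det_transpose]; exact isUnit_det_confPoint
  have h : confField * (veroneseMatrix confPoint)ᵀ = Matrix.of fun i k => confPoint k i := by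
    rw [confField, Matrix.mul_assoc, Matrix.nonsing_inv_mul _ hu, Matrix.mul_one]
  ext i
  exact congrFun (congrFun h i) k

theorem isUnit_aeval_of_mem_powers {y : Fin 6 → Fin 3 → ℂ} (hy : (veroneseMatrix y).det ≠ 0)
    (r : Submonoid.powers confDet) :
    IsUnit (MvPolynomial.aeval (fun q : Fin 6 × Fin 3 => y q.1 q.2) (r : MvPolynomial _ ℂ)) := by
  obtain ⟨r, n, rfl⟩ := r
  simp only [map_pow, aeval_confDet]
  exact (isUnit_iff_ne_zero.mpr hy).pow n

/-- The evaluation of regular functions at a configuration of six points not lying on a conic. -/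
noncomputable def confEval (y : Fin 6 → Fin 3 → ℂ) (hy : (veroneseMatrix y).det ≠ 0) :
    ConfRing →ₐ[ℂ] ℂ :=
  IsLocalization.liftAlgHom (M := Submonoid.powers confDet) (isUnit_aeval_of_mem_powers hy)

theorem confEval_confPoint {y : Fin 6 → Fin 3 → ℂ} (hy : (veroneseMatrix y).det ≠ 0) (k : Fin 6)
    (i : Fin 3) : confEval y hy (confPoint k i) = y k i := by
  rw [confEval, IsLocalization.liftAlgHom_apply, confPoint, IsLocalization.lift_eq]
  simp [confVar]

/-- By uniqueness, any field fixing six points not on a conic is a specialization of `confField`.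
This is how the algebra of `ConfRing` reaches actual fields. -/
theorem map_confField_of_fixed {T : Matrix (Fin 3) (Fin 6) ℂ} {y : Fin 6 → Fin 3 → ℂ}
    (hy : (veroneseMatrix y).det ≠ 0) (hT : ∀ k, T *ᵥ veronese (y k) = y k) :
    confField.map (confEval y hy) = T := by
  refine eq_of_mulVec_veronese_eq (isUnit_iff_ne_zero.mpr hy) fun k => ?_
  rw [hT]
  ext i
  have h := congrArg (confEval y hy) (congrFun (confField_mulVec_veronese k) i)
  rw [confEval_confPoint] at h
  rw [← h]
  refine Eq.trans ?_ ((confEval y hy : ConfRing →+* ℂ).map_mulVec _ _ i).symm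
  congr 2
  ext J
  refine Eq.trans ?_ (veronese_map (confEval y hy : ConfRing →+* ℂ) (confPoint k) J).symm
  congr 1
  ext j
  exact (confEval_confPoint hy k j).symm

theorem confDerivation_eq_zero (D : Derivation ℂ ConfRing (FractionRing ConfRing))
    (h : ∀ k i, D (confPoint k i) = 0) : D = 0 := by
  have h0 : ∀ r, D (algebraMap (MvPolynomial (Fin 6 × Fin 3) ℂ) ConfRing r) = 0 := by
    intro r
    induction r using MvPolynomial.induction_on with
    | C a => exact D.map_algebraMap a
    | add p q hp hq => rw [map_add, map_add, hp, hq, add_zero]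
    | mul_X p q hp =>
      rw [map_mul, Derivation.leibniz, hp, smul_zero, add_zero]
      rw [show D (algebraMap _ ConfRing (MvPolynomial.X q)) = 0 from h q.1 q.2, smul_zero]
  ext x
  obtain ⟨⟨r, s⟩, hx⟩ := IsLocalization.surj (Submonoid.powers confDet) x
  have hD := congrArg D hx
  rw [Derivation.leibniz, h0, h0, smul_zero, zero_add] at hD
  have hs : algebraMap _ ConfRing (s : MvPolynomial (Fin 6 × Fin 3) ℂ) ≠ 0 :=
    (IsLocalization.map_units ConfRing s).ne_zero
  exact (smul_eq_zero.mp hD).resolve_left hs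

/-- The variations given by a derivation. -/
noncomputable def derivationVar (D : Derivation ℂ ConfRing (FractionRing ConfRing)) :
    VarIdx → FractionRing ConfRing :=
  Sum.elim (fun q => D (confField q.1 q.2)) fun q => D (confPoint q.1 q.2)

/-- The linearized conditions at the generic configuration, over the rational functions. -/
noncomputable def confLin :
    (VarIdx → FractionRing ConfRing) →ₗ[FractionRing ConfRing] (CondIdx → FractionRing ConfRing) :=
  linearization (confField.map (algebraMap ConfRing (FractionRing ConfRing)))
    fun k i => algebraMap ConfRing (FractionRing ConfRing) (confPoint k i)

section

variable (D : Derivation ℂ ConfRing (FractionRing ConfRing))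

local notation "ι" => algebraMap ConfRing (FractionRing ConfRing)

theorem map_jacobian_derivation (k : Fin 6) :
    (confField * dVeronese (confPoint k)).map D =
      jacVariation (confField.map ι) (varField (derivationVar D)) (fun i => ι (confPoint k i))
        (varPoint (derivationVar D) k) := by
  rw [D.map_matrix_mul, jacVariation, D.map_dVeronese, map_dVeronese]
  rfl

theorem confLin_fixed (k : Fin 6) (i : Fin 3) : confLin (derivationVar D) (.inl (k, i)) = 0 := by
  have h := congrArg D (congrFun (confField_mulVec_veronese k) i)
  rw [D.map_matrix_mulVec] at h
  simp only [confLin, linearization, LinearMap.coe_mk, AddHom.coe_mk, Sum.elim_inl, Pi.sub_apply,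
    Pi.add_apply]
  rw [sub_eq_zero]
  refine Eq.trans ?_ h
  simp only [D.map_veronese, veronese_map]
  rw [← Matrix.mulVec_mulVec]
  rfl

theorem confLin_trace (k : Fin 6) : confLin (derivationVar D) (.inr (.inr (.inl k))) =
    D (confField * dVeronese (confPoint k)).trace := by
  have h : D (confField * dVeronese (confPoint k)).trace =
      ((confField * dVeronese (confPoint k)).map D).trace := by
    simp [Matrix.trace]
  rw [h, map_jacobian_derivation]
  rfl

theorem confLin_det (k : Fin 3) : confLin (derivationVar D) (.inr (.inr (.inr k))) =
    - D (1 - confField * dVeronese (confPoint (firstThree k))).det := by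
  have h : (1 - confField * dVeronese (confPoint (firstThree k))).map D =
      - (confField * dVeronese (confPoint (firstThree k))).map D := by
    ext i j
    by_cases hij : i = j
    · simp [hij]
    · simp [Matrix.one_apply_ne hij]
  rw [D.map_det_fin_three, h, map_jacobian_derivation, Matrix.mul_neg, Matrix.trace_neg, neg_neg,
    Matrix.map_sub ι (map_sub ι), Matrix.map_one ι (map_zero ι) (map_one ι), Matrix.map_mul,
    map_dVeronese]
  rfl

end

theorem map_confField_base :
    confField.map (confEval basePoints det_veroneseMatrix_basePoints) = baseField :=
  map_confField_of_fixed _ baseField_mulVec_veronese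

/-- The matrix of the linearization commutes with ring homomorphisms, so injectivity over the
fraction field follows from injectivity at the base configuration. -/
theorem confLin_injective {u : VarIdx → FractionRing ConfRing} (hu : confLin u = 0) : u = 0 := by
  set φ := confEval basePoints det_veroneseMatrix_basePoints with hφdef
  have hφp : (fun k i => (φ : ConfRing →+* ℂ) (confPoint k i)) = basePoints := by
    ext k i
    exact confEval_confPoint det_veroneseMatrix_basePoints k i
  have hmap : ∀ {B : Type} [CommRing B] (ψ : ConfRing →+* B),
      (LinearMap.toMatrix' (linearization confField confPoint)).map ψ =
        LinearMap.toMatrix' (linearization (confField.map ψ) fun k i => ψ (confPoint k i)) := by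
    intro B _ ψ
    ext r v
    simp only [Matrix.map_apply, LinearMap.toMatrix'_apply]
    rw [linearization_map]
    refine congrArg (fun w => linearization _ _ w r) ?_
    ext w
    simp only [Pi.single_apply]
    split_ifs <;> simp
  refine eq_zero_of_mulVec_eq_zero_of_specialization
    (LinearMap.toMatrix' (linearization confField confPoint)) φ ?_ u ?_
  · intro v hv
    apply eq_zero_of_linearization_base
    rw [← map_confField_base, ← hφdef, ← hφp, ← hv]
    refine Eq.trans ?_ (congrArg (fun A : Matrix _ _ ℂ => A *ᵥ v)
      (hmap (φ : ConfRing →+* ℂ)).symm)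
    exact (LinearMap.toMatrix'_mulVec _ _).symm
  · rw [hmap, ← hu]
    exact LinearMap.toMatrix'_mulVec _ _

/-! ### Finiteness of the configurations with given exponents. -/

/-- The functions of a configuration that the exponents and the first three points determine. -/
def exponentData : Set ConfRing :=
  Set.range (fun q : Fin 3 × Fin 3 => confPoint (firstThree q.1) q.2) ∪
    (Set.range (fun k : Fin 6 => (confField * dVeronese (confPoint k)).trace) ∪
    Set.range fun k : Fin 3 => (1 - confField * dVeronese (confPoint (firstThree k))).det)

/-- A derivation that kills the data solves the linearized equations, so it kills all coordinates of
the points, and these generate `ConfRing` up to a localization. -/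
theorem isAlgebraic_adjoin_exponentData (x : ConfRing) :
    IsAlgebraic (Algebra.adjoin ℂ exponentData) x := by
  refine isAlgebraic_adjoin_of_derivation_eq_zero _ (fun D hD => ?_) x
  have hu : derivationVar D = 0 := by
    apply confLin_injective
    ext r
    rcases r with ⟨k, i⟩ | ⟨k, i⟩ | k | k
    · exact confLin_fixed D k i
    · exact hD _ (Or.inl ⟨(k, i), rfl⟩)
    · rw [confLin_trace, hD _ (Or.inr (Or.inl ⟨k, rfl⟩))]
      rfl
    · rw [confLin_det, hD _ (Or.inr (Or.inr ⟨k, rfl⟩)), neg_zero]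
      rfl
  exact confDerivation_eq_zero D fun k i => congrFun hu (.inr (k, i))

theorem exists_ne_zero_finite_configurations :
    ∃ c : ConfRing, c ≠ 0 ∧ ∀ φ : ConfRing →ₐ[ℂ] ℂ, φ c ≠ 0 →
      {y : Fin 6 → Fin 3 → ℂ | ∃ ψ : ConfRing →ₐ[ℂ] ℂ,
        (∀ a ∈ exponentData, ψ a = φ a) ∧ ∀ k i, ψ (confPoint k i) = y k i}.Finite := by
  choose c hc0 hc using fun q : Fin 6 × Fin 3 => exists_ne_zero_finite_specializations
    exponentData (confPoint q.1 q.2) (isAlgebraic_adjoin_exponentData _)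
  refine ⟨∏ q, c q, Finset.prod_ne_zero_iff.mpr fun q _ => hc0 q, fun φ hφ => ?_⟩
  have hq : ∀ q, φ (c q) ≠ 0 := fun q => by
    rw [map_prod] at hφ
    exact Finset.prod_ne_zero_iff.mp hφ q (Finset.mem_univ q)
  refine (Set.Finite.pi' fun k => Set.Finite.pi' fun i => hc (k, i) φ (hq (k, i))).subset ?_
  rintro y ⟨ψ, hψ, hy⟩ k i
  exact ⟨ψ, hψ, hy k i⟩

theorem det_one_sub_base_ne_zero (k : Fin 6) :
    (1 - baseField * dVeronese (basePoints k)).det ≠ 0 := by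
  rw [Matrix.det_fin_three, dVeronese_eq]
  simp only [Matrix.sub_apply, Matrix.mul_apply, Fin.sum_univ_six]
  fin_cases k <;> simp [baseField, basePoints] <;> norm_num

theorem map_confField_mul {T : Matrix (Fin 3) (Fin 6) ℂ} {y : Fin 6 → Fin 3 → ℂ}
    (hy : (veroneseMatrix y).det ≠ 0) (hT : ∀ k, T *ᵥ veronese (y k) = y k) (k : Fin 6) :
    (confField * dVeronese (confPoint k)).map (confEval y hy) = T * dVeronese (y k) := by
  have h := map_dVeronese (confEval y hy : ConfRing →+* ℂ) (confPoint k)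
  rw [show (fun i => (confEval y hy : ConfRing →+* ℂ) (confPoint k i)) = y k from
    funext fun i => confEval_confPoint hy k i] at h
  rw [← h, ← map_confField_of_fixed hy hT]
  exact Matrix.map_mul (f := (confEval y hy : ConfRing →+* ℂ))

theorem confEval_trace {T : Matrix (Fin 3) (Fin 6) ℂ} {y : Fin 6 → Fin 3 → ℂ}
    (hy : (veroneseMatrix y).det ≠ 0) (hT : ∀ k, T *ᵥ veronese (y k) = y k) (k : Fin 6) :
    confEval y hy (confField * dVeronese (confPoint k)).trace = (T * dVeronese (y k)).trace := by
  rw [← map_confField_mul hy hT k]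
  simp only [Matrix.trace, Matrix.diag_apply, map_sum, Matrix.map_apply]

theorem confEval_det {T : Matrix (Fin 3) (Fin 6) ℂ} {y : Fin 6 → Fin 3 → ℂ}
    (hy : (veroneseMatrix y).det ≠ 0) (hT : ∀ k, T *ᵥ veronese (y k) = y k) (k : Fin 6) :
    confEval y hy (1 - confField * dVeronese (confPoint k)).det =
      (1 - T * dVeronese (y k)).det := by
  rw [← map_confField_mul hy hT k, AlgHom.map_det, map_sub, map_one]
  rfl

theorem det_one_sub_conf_ne_zero (k : Fin 6) :
    (1 - confField * dVeronese (confPoint k)).det ≠ 0 := by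
  intro h
  apply det_one_sub_base_ne_zero k
  rw [← confEval_det det_veroneseMatrix_basePoints baseField_mulVec_veronese, h, map_zero]

/-- Differentiating the fixed point equation with the field held constant gives `(1 - M) dp = 0`,
and `1 - M` is invertible generically because it is so at the base points. -/
theorem isAlgebraic_adjoin_confField (x : ConfRing) :
    IsAlgebraic (Algebra.adjoin ℂ (Set.range fun q : Fin 3 × Fin 6 => confField q.1 q.2)) x := by
  refine isAlgebraic_adjoin_of_derivation_eq_zero _ (fun D hD => ?_) x
  apply confDerivation_eq_zero D
  intro k
  have hD0 : varField (derivationVar D) = 0 := by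
    ext i J
    exact hD _ ⟨(i, J), rfl⟩
  have h := confLin_fixed D k
  simp only [confLin, linearization, LinearMap.coe_mk, AddHom.coe_mk, Sum.elim_inl, hD0,
    Matrix.zero_mulVec, zero_add] at h
  have h1 : (1 - confField * dVeronese (confPoint k)).map
      (algebraMap ConfRing (FractionRing ConfRing)) *ᵥ varPoint (derivationVar D) k = 0 := by
    rw [Matrix.map_sub _ (map_sub _), Matrix.map_one _ (map_zero _) (map_one _), Matrix.map_mul,
      map_dVeronese, Matrix.sub_mulVec, Matrix.one_mulVec]
    ext i
    have := h i
    simp only [Pi.sub_apply, Pi.zero_apply] at this ⊢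
    rw [← neg_eq_zero, ← this, neg_sub]
  have h2 : varPoint (derivationVar D) k = 0 := by
    refine Matrix.eq_zero_of_mulVec_eq_zero ?_ h1
    rw [← RingHom.mapMatrix_apply, ← RingHom.map_det]
    exact fun h0 => det_one_sub_conf_ne_zero k
      ((IsFractionRing.injective ConfRing (FractionRing ConfRing)) (h0.trans (map_zero _).symm))
  exact fun i => congrFun h2 i

/-- Converts an open condition on configurations into one on fields. It holds for all choices and
orderings of six fixed points at once, as required since the matching of fixed points is not known
in advance. -/
theorem genericallyMatrix_confEval_ne_zero {G : ConfRing} (hG : G ≠ 0) :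
    QuadVF.GenericallyMatrix fun T => ∀ (y : Fin 6 → Fin 3 → ℂ) (hy : (veroneseMatrix y).det ≠ 0),
      (∀ k, T *ᵥ veronese (y k) = y k) → confEval y hy G ≠ 0 := by
  obtain ⟨F, hF0, hF⟩ := exists_ne_zero_forall_eval_eq_zero
    (fun q : Fin 3 × Fin 6 => confField q.1 q.2) G (isAlgebraic_adjoin_confField G) hG
  refine ⟨F, hF0, fun T hT y hy hTy h => hT ?_⟩
  have := hF _ h
  rw [← map_confField_of_fixed hy hTy]
  exact this

/-! ### Elimination: nondegeneracy and the upper bound on the number of fixed points. -/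

/-- The value of a monomial in three variables. -/
def monVal (n : Fin 3 → ℕ) (z : Fin 3 → ℂ) : ℂ := ∏ i, z i ^ n i

theorem monVal_add (m n : Fin 3 → ℕ) (z : Fin 3 → ℂ) :
    monVal (m + n) z = monVal m z * monVal n z := by
  simp [monVal, pow_add, Finset.prod_mul_distrib]

theorem monVal_single (i : Fin 3) (r : ℕ) (z : Fin 3 → ℂ) :
    monVal (Pi.single i r) z = z i ^ r := by
  rw [monVal, Finset.prod_eq_single i]
  · simp
  · intro j _ hj
    simp [hj]
  · simp

/-- The exponents of the quadratic monomials. -/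
def quadExp (J : Fin 6) : Fin 3 → ℕ := Pi.single (quadIdx J).1 1 + Pi.single (quadIdx J).2 1

theorem monVal_quadExp (J : Fin 6) (z : Fin 3 → ℂ) : monVal (quadExp J) z = veronese z J := by
  rw [quadExp, monVal_add, monVal_single, monVal_single, pow_one, pow_one]
  rfl

theorem sum_quadExp (J : Fin 6) : ∑ i, quadExp J i = 2 := by
  simp [quadExp, Finset.sum_add_distrib]

/-- The exponents of the monomials of degree at most four that are not squarefree. -/
def nonSquarefree : Finset (Fin 3 → ℕ) :=
  (Fintype.piFinset fun _ => Finset.range 5).filter fun n => (∃ i, 2 ≤ n i) ∧ ∑ i, n i ≤ 4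

theorem mem_nonSquarefree {n : Fin 3 → ℕ} :
    n ∈ nonSquarefree ↔ (∃ i, 2 ≤ n i) ∧ ∑ i, n i ≤ 4 := by
  simp only [nonSquarefree, Finset.mem_filter, Fintype.mem_piFinset, Finset.mem_range,
    and_iff_right_iff_imp]
  intro h i
  have := Finset.single_le_sum (f := n) (fun _ _ => Nat.zero_le _) (Finset.mem_univ i)
  omega

theorem exists_double (n : nonSquarefree) : ∃ i, 2 ≤ n.1 i := (mem_nonSquarefree.mp n.2).1

/-- A variable whose square divides a monomial that is not squarefree. -/
noncomputable def doubleVar (n : nonSquarefree) : Fin 3 := (exists_double n).choose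

/-- The quotient of a monomial by the square of a variable. -/
noncomputable def reduced (n : nonSquarefree) : Fin 3 → ℕ := n.1 - Pi.single (doubleVar n) 2

theorem reduced_add (n : nonSquarefree) : reduced n + Pi.single (doubleVar n) 2 = n.1 := by
  ext i
  have h : 2 ≤ n.1 (doubleVar n) := (exists_double n).choose_spec
  simp only [reduced, Pi.add_apply, Pi.sub_apply, Pi.single_apply]
  split_ifs with hi
  · subst hi
    omega
  · omega

theorem sum_reduced (n : nonSquarefree) : ∑ i, reduced n i + 2 = ∑ i, n.1 i := by
  rw [← reduced_add n]
  simp [Finset.sum_add_distrib]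

/-- The matrix of the elimination of the monomials of degree at most four that are not
squarefree by the relations `X(z) = z`. -/
noncomputable def elimMatrix {S : Type} [CommRing S] (T : Matrix (Fin 3) (Fin 6) S) :
    Matrix nonSquarefree nonSquarefree S :=
  Matrix.of fun n m => (∑ J, if reduced n + quadExp J = m.1 then T (doubleVar n) J else 0) -
    if reduced n + Pi.single (doubleVar n) 1 = m.1 then 1 else 0

theorem elimMatrix_map {S S' : Type} [CommRing S] [CommRing S'] (φ : S →+* S')
    (T : Matrix (Fin 3) (Fin 6) S) : (elimMatrix T).map φ = elimMatrix (T.map φ) := by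
  ext n m
  simp only [elimMatrix, Matrix.map_apply, Matrix.of_apply, map_sub, map_sum, apply_ite φ,
    map_zero, map_one]

/-- The row of `n` is the relation `X(z) = z` in the component `doubleVar n`, multiplied by the
monomial `reduced n`. Terms outside the index set are squarefree, and `u` vanishes there. The bound
four is the least that allows multiplying the squarefree monomials by a variable. -/
theorem elimMatrix_mulVec (T : Matrix (Fin 3) (Fin 6) ℂ) (u : (Fin 3 → ℕ) → ℂ)
    (hu : ∀ m, (∀ i, m i ≤ 1) → u m = 0) (n : nonSquarefree) :
    (elimMatrix T *ᵥ fun m => u m.1) n =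
      ∑ J, T (doubleVar n) J * u (reduced n + quadExp J) -
        u (reduced n + Pi.single (doubleVar n) 1) := by
  have hn := (mem_nonSquarefree.mp n.2).2
  have hr := sum_reduced n
  have key : ∀ (q : Fin 3 → ℕ) (a : ℂ), ∑ i, q i ≤ 4 →
      ∑ m : nonSquarefree, (if q = m.1 then a else 0) * u m.1 = a * u q := by
    intro q a hq
    by_cases h : q ∈ nonSquarefree
    · rw [Finset.sum_eq_single (⟨q, h⟩ : nonSquarefree)]
      · simp
      · intro m _ hm
        rw [if_neg, zero_mul]
        intro h'
        exact hm (Subtype.ext h'.symm)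
      · simp
    · rw [hu q, mul_zero]
      · refine Finset.sum_eq_zero fun m _ => ?_
        rw [if_neg, zero_mul]
        rintro rfl
        exact h m.2
      · intro i
        by_contra hi
        exact h (mem_nonSquarefree.mpr ⟨⟨i, by omega⟩, hq⟩)
  simp only [Matrix.mulVec, dotProduct, elimMatrix, Matrix.of_apply, sub_mul,
    Finset.sum_sub_distrib, Finset.sum_mul]
  congr 1
  · rw [Finset.sum_comm]
    refine Finset.sum_congr rfl fun J _ => key _ _ ?_
    have := sum_quadExp J
    simp only [Pi.add_apply, Finset.sum_add_distrib]
    omega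
  · refine (key _ 1 ?_).trans (one_mul _)
    simp only [Pi.add_apply, Finset.sum_add_distrib, Finset.sum_pi_single', Finset.mem_univ,
      if_true]
    omega

/-- The coefficients of the field `x², y², z²`. -/
def cubeField : Matrix (Fin 3) (Fin 6) ℂ :=
  Matrix.of fun i J => if J = firstThree i then 1 else 0

theorem quadExp_firstThree (i : Fin 3) : quadExp (firstThree i) = Pi.single i 2 := by
  ext j
  fin_cases i <;> fin_cases j <;> rfl

/-- For the field `x², y², z²` each relation equates a monomial to one of degree one less, so the
system is triangular and a kernel vector vanishes by induction on the degree. -/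
theorem det_elimMatrix_cubeField : (elimMatrix cubeField).det ≠ 0 := by
  intro h
  obtain ⟨u, hu0, hu⟩ := Matrix.exists_mulVec_eq_zero_iff.mpr h
  apply hu0
  let v : (Fin 3 → ℕ) → ℂ := fun m => if hm : m ∈ nonSquarefree then u ⟨m, hm⟩ else 0
  have hv : ∀ m : nonSquarefree, v m.1 = u m := fun m => dif_pos m.2
  have hv0 : ∀ m, (∀ i, m i ≤ 1) → v m = 0 := by
    intro m hm
    refine dif_neg fun h => ?_
    obtain ⟨i, hi⟩ := (mem_nonSquarefree.mp h).1
    have := hm i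
    omega
  have hrow : ∀ n : nonSquarefree, u n = v (reduced n + Pi.single (doubleVar n) 1) := by
    intro n
    have h1 := elimMatrix_mulVec cubeField v hv0 n
    simp only [hv] at h1
    rw [hu] at h1
    simp only [cubeField, Matrix.of_apply, ite_mul, one_mul, zero_mul, Finset.sum_ite_eq',
      Finset.mem_univ, if_true, quadExp_firstThree, reduced_add, hv, Pi.zero_apply] at h1
    exact sub_eq_zero.mp h1.symm
  have hall : ∀ (d : ℕ) (n : nonSquarefree), ∑ i, n.1 i < d → u n = 0 := by
    intro d
    induction d with
    | zero => intro n hn; omega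
    | succ d ih =>
      intro n hn
      rw [hrow]
      by_cases hm : reduced n + Pi.single (doubleVar n) 1 ∈ nonSquarefree
      · rw [show v (reduced n + Pi.single (doubleVar n) 1) = u ⟨_, hm⟩ from dif_pos hm]
        apply ih
        have := sum_reduced n
        simp only [Pi.add_apply, Finset.sum_add_distrib, Finset.sum_pi_single', Finset.mem_univ,
          if_true]
        omega
      · exact dif_neg hm
  ext n
  exact hall _ n (Nat.lt_succ_self _)

section Elimination

variable {T : Matrix (Fin 3) (Fin 6) ℂ}

theorem eq_zero_of_det_elimMatrix (hT : (elimMatrix T).det ≠ 0) {z : Fin 3 → ℂ}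
    (hz : T *ᵥ veronese z = 0) : z = 0 := by
  -- Keeping only degree four removes the linear part of the relations, so a zero of `X` yields a
  -- kernel vector. It contains the fourth powers of the coordinates.
  let u : (Fin 3 → ℕ) → ℂ := fun m => if ∑ i, m i = 4 then monVal m z else 0
  have hu : (fun m : nonSquarefree => u m.1) = 0 := by
    refine Matrix.eq_zero_of_mulVec_eq_zero hT ?_
    ext n
    rw [elimMatrix_mulVec]
    · have hr := sum_reduced n
      have hn := (mem_nonSquarefree.mp n.2).2
      have h1 : u (reduced n + Pi.single (doubleVar n) 1) = 0 := by
        refine if_neg ?_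
        simp only [Pi.add_apply, Finset.sum_add_distrib, Finset.sum_pi_single', Finset.mem_univ,
          if_true]
        omega
      have hs : ∀ J, ∑ i, (reduced n + quadExp J) i = ∑ i, n.1 i := fun J => by
        simp only [Pi.add_apply, Finset.sum_add_distrib, sum_quadExp, hr]
      rw [h1, sub_zero, Pi.zero_apply]
      by_cases h4 : ∑ i, n.1 i = 4
      · simp only [u, hs, h4, if_true, monVal_add, monVal_quadExp]
        have := congrFun hz (doubleVar n)
        simp only [Matrix.mulVec, dotProduct, Pi.zero_apply] at this
        rw [← mul_zero (monVal (reduced n) z), ← this, Finset.mul_sum]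
        exact Finset.sum_congr rfl fun J _ => by ring
      · simp only [u, hs, h4, if_false, mul_zero, Finset.sum_const_zero]
    · intro m hm
      refine if_neg ?_
      have := Finset.sum_le_sum fun i (_ : i ∈ Finset.univ) => hm i
      simp only [Finset.sum_const, Finset.card_univ, Fintype.card_fin, smul_eq_mul] at this
      omega
  ext i
  have hmem : (Pi.single i 4 : Fin 3 → ℕ) ∈ nonSquarefree :=
    mem_nonSquarefree.mpr ⟨⟨i, by simp⟩, by simp⟩
  have := congrFun hu ⟨_, hmem⟩
  simp only [u, Finset.sum_pi_single', Finset.mem_univ, if_true, monVal_single,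
    Pi.zero_apply] at this
  exact pow_eq_zero_iff (by norm_num) |>.mp this

theorem not_injective_of_det_elimMatrix (hT : (elimMatrix T).det ≠ 0) {p : Fin 9 → Fin 3 → ℂ}
    (hp : ∀ k, T *ᵥ veronese (p k) = p k) : ¬ Function.Injective p := by
  intro hinj
  -- The weights on the nine points for which the eight squarefree monomials have weighted sum zero;
  -- such nonzero weights exist since `9 > 8`. Elimination makes `U` stable under multiplication by
  -- the coordinates, hence by all polynomials.
  let U : Submodule ℂ (Fin 9 → ℂ) :=
    ⨅ s : Fin 3 → Fin 2, LinearMap.ker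
      (∑ k, monVal (fun i => (s i : ℕ)) (p k) • LinearMap.proj (R := ℂ) (φ := fun _ => ℂ) k)
  have hU : ∀ c, c ∈ U ↔ ∀ m : Fin 3 → ℕ, (∀ i, m i ≤ 1) → ∑ k, c k * monVal m (p k) = 0 := by
    intro c
    simp only [U, Submodule.mem_iInf, LinearMap.mem_ker, LinearMap.sum_apply, LinearMap.smul_apply,
      LinearMap.proj_apply, smul_eq_mul]
    constructor
    · intro h m hm
      have := h fun i => ⟨m i, Nat.lt_succ_of_le (hm i)⟩
      rw [← this]
      exact Finset.sum_congr rfl fun k _ => mul_comm _ _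
    · intro h s
      rw [← h (fun i => (s i : ℕ)) fun i => Nat.lt_succ_iff.mp (s i).2]
      exact Finset.sum_congr rfl fun k _ => mul_comm _ _
  obtain ⟨c, hcU, hc0⟩ : ∃ c ∈ U, c ≠ 0 := by
    let B : (Fin 9 → ℂ) →ₗ[ℂ] ((Fin 3 → Fin 2) → ℂ) := LinearMap.pi fun s =>
      (∑ k, monVal (fun i => (s i : ℕ)) (p k) • LinearMap.proj (R := ℂ) (φ := fun _ => ℂ) k)
    have hB : ¬ Function.Injective B := by
      intro h
      have := LinearMap.finrank_le_finrank_of_injective h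
      simp at this
    rw [← LinearMap.ker_eq_bot, LinearMap.ker_eq_bot'] at hB
    push Not at hB
    obtain ⟨c, hc, hc0⟩ := hB
    refine ⟨c, ?_, hc0⟩
    simp only [U, Submodule.mem_iInf, LinearMap.mem_ker]
    exact fun s => congrFun hc s
  have hX : ∀ c ∈ U, ∀ j, (fun k => c k * p k j) ∈ U := by
    intro c hc j
    rw [hU] at hc ⊢
    let u : (Fin 3 → ℕ) → ℂ := fun m => ∑ k, c k * monVal m (p k)
    have hu : (fun m : nonSquarefree => u m.1) = 0 := by
      refine Matrix.eq_zero_of_mulVec_eq_zero hT ?_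
      ext n
      rw [elimMatrix_mulVec _ _ hc, Pi.zero_apply]
      simp only [monVal_add, monVal_quadExp, monVal_single, pow_one, Finset.mul_sum]
      rw [Finset.sum_comm, ← Finset.sum_sub_distrib]
      refine Finset.sum_eq_zero fun k _ => ?_
      have := congrFun (hp k) (doubleVar n)
      rw [← this, Matrix.mulVec, dotProduct, Finset.mul_sum, Finset.mul_sum,
        ← Finset.sum_sub_distrib]
      exact Finset.sum_eq_zero fun J _ => by ring
    intro m hm
    have h1 : ∑ k, c k * p k j * monVal m (p k) = u (m + Pi.single j 1) := by
      refine Finset.sum_congr rfl fun k _ => ?_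
      rw [monVal_add, monVal_single, pow_one]
      ring
    rw [h1]
    by_cases h : m + Pi.single j 1 ∈ nonSquarefree
    · exact congrFun hu ⟨_, h⟩
    · refine hc _ fun i => ?_
      by_contra hi
      apply h
      refine mem_nonSquarefree.mpr ⟨⟨i, by omega⟩, ?_⟩
      have := Finset.sum_le_sum fun i (_ : i ∈ Finset.univ) => hm i
      simp only [Finset.sum_const, Finset.card_univ, Fintype.card_fin, smul_eq_mul] at this
      simp only [Pi.add_apply, Finset.sum_add_distrib, Finset.sum_pi_single', Finset.mem_univ,
        if_true]
      omega
  have hf : ∀ (f : MvPolynomial (Fin 3) ℂ), ∀ c ∈ U,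
      (fun k => c k * MvPolynomial.eval (p k) f) ∈ U := by
    intro f
    induction f using MvPolynomial.induction_on with
    | C a =>
      intro c hc
      simpa [mul_comm, Pi.smul_def] using U.smul_mem a hc
    | add f g hf hg =>
      intro c hc
      simpa [mul_add, Pi.add_def] using U.add_mem (hf c hc) (hg c hc)
    | mul_X f j hf =>
      intro c hc
      simpa [mul_assoc] using hX _ (hf c hc) j
  obtain ⟨k₀, hk₀⟩ := Function.ne_iff.mp hc0
  have hsep : ∀ k, k ≠ k₀ → ∃ j, p k j ≠ p k₀ j := fun k hk => Function.ne_iff.mp (hinj.ne hk)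
  choose! j hj using hsep
  -- A polynomial vanishing at all the points but `p k₀` isolates the weight `c k₀`, which must then
  -- be zero.
  let f : MvPolynomial (Fin 3) ℂ := ∏ k ∈ Finset.univ.erase k₀,
    (MvPolynomial.X (j k) - MvPolynomial.C (p k (j k)))
  have hfk : ∀ k, MvPolynomial.eval (p k) f =
      ∏ l ∈ Finset.univ.erase k₀, (p k (j l) - p l (j l)) := fun k => by
    simp [f, map_prod]
  have h1 := (hU _).mp (hf f c hcU) 0 (fun i => Nat.zero_le _)
  simp only [hfk, monVal, Pi.zero_apply, pow_zero, Finset.prod_const_one, mul_one] at h1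
  rw [Finset.sum_eq_single k₀] at h1
  · rcases mul_eq_zero.mp h1 with h | h
    · exact hk₀ h
    · obtain ⟨l, hl, hl0⟩ := Finset.prod_eq_zero_iff.mp h
      exact hj l (Finset.ne_of_mem_erase hl) (sub_eq_zero.mp hl0).symm
  · intro k _ hk
    rw [Finset.prod_eq_zero (Finset.mem_erase.mpr ⟨hk, Finset.mem_univ k⟩) (sub_self _), mul_zero]
  · simp

end Elimination

theorem genericallyMatrix_det_elimMatrix :
    QuadVF.GenericallyMatrix fun T => (elimMatrix T).det ≠ 0 := by
  let X : Matrix (Fin 3) (Fin 6) (MvPolynomial (Fin 3 × Fin 6) ℂ) :=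
    Matrix.of fun i J => MvPolynomial.X (i, J)
  have h : ∀ T : Matrix (Fin 3) (Fin 6) ℂ,
      MvPolynomial.eval (fun q => T q.1 q.2) (elimMatrix X).det = (elimMatrix T).det := by
    intro T
    rw [RingHom.map_det, RingHom.mapMatrix_apply, elimMatrix_map]
    congr 2
    ext i J
    simp [X]
  refine ⟨(elimMatrix X).det, fun h0 => det_elimMatrix_cubeField ?_, fun T hT => (h T).symm.trans_ne hT⟩
  rw [← h, h0, map_zero]

/-! ### Existence of seven simple fixed points for a generic field. -/

section SevenPoints

open MvPolynomial

/-- The polynomials in the coefficients of a field. -/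
abbrev FieldRing : Type := MvPolynomial (Fin 3 × Fin 6) ℂ

/-- The polynomials in the coefficients of a field and seven points. -/
abbrev SevenRing : Type := MvPolynomial (Fin 7 × Fin 3) FieldRing

/-- The generic field. -/
noncomputable def sevenField : Matrix (Fin 3) (Fin 6) SevenRing :=
  Matrix.of fun i J => C (X (i, J))

/-- The generic points. -/
noncomputable def sevenPoint (k : Fin 7) (i : Fin 3) : SevenRing := X (k, i)

/-- The condition that the points are fixed. -/
noncomputable def sevenEq (q : Fin 7 × Fin 3) : SevenRing :=
  (sevenField *ᵥ veronese (sevenPoint q.1)) q.2 - sevenPoint q.1 q.2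

/-- A linear form separating the vertices of a cube. -/
def cubeForm {S : Type} [CommRing S] (z : Fin 3 → S) : S := z 0 + 2 * z 1 + 4 * z 2

/-- The open conditions that seven points are distinct, nonzero and simple. -/
noncomputable def sevenOpen : SevenRing :=
  (∏ k, cubeForm (sevenPoint k) * (1 - sevenField * dVeronese (sevenPoint k)).det) *
    ∏ q ∈ (Finset.univ : Finset (Fin 7)).offDiag,
      (cubeForm (sevenPoint q.1) - cubeForm (sevenPoint q.2))

/-- The nonzero vertices of the unit cube. -/
def cubePoint : Fin 7 → Fin 3 → ℂ :=
  ![![1, 0, 0], ![0, 1, 0], ![1, 1, 0], ![0, 0, 1], ![1, 0, 1], ![0, 1, 1], ![1, 1, 1]]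

variable (T : Matrix (Fin 3) (Fin 6) ℂ) (p : Fin 7 → Fin 3 → ℂ)

/-- The evaluation at a field and seven points. -/
noncomputable def sevenEval : SevenRing →+* ℂ :=
  eval₂Hom (eval fun q => T q.1 q.2) fun q => p q.1 q.2

theorem sevenEval_field : sevenField.map (sevenEval T p) = T := by
  ext i J
  simp [sevenEval, sevenField]

theorem sevenEval_point (k : Fin 7) (i : Fin 3) : sevenEval T p (sevenPoint k i) = p k i := by
  simp [sevenEval, sevenPoint]

theorem sevenEval_jacobian (k : Fin 7) :
    (sevenField * dVeronese (sevenPoint k)).map (sevenEval T p) = T * dVeronese (p k) := by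
  rw [Matrix.map_mul, sevenEval_field, map_dVeronese]
  simp only [sevenEval_point]

theorem sevenEval_eq (q : Fin 7 × Fin 3) :
    sevenEval T p (sevenEq q) = (T *ᵥ veronese (p q.1)) q.2 - p q.1 q.2 := by
  rw [sevenEq, map_sub, sevenEval_point, RingHom.map_mulVec, sevenEval_field]
  congr 3
  ext J
  refine (veronese_map (sevenEval T p) _ J).trans ?_
  simp only [sevenEval_point]

theorem sevenEval_open : sevenEval T p sevenOpen =
    (∏ k, cubeForm (p k) * (1 - T * dVeronese (p k)).det) *
      ∏ q ∈ (Finset.univ : Finset (Fin 7)).offDiag, (cubeForm (p q.1) - cubeForm (p q.2)) := by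
  have h1 : ∀ k, sevenEval T p (cubeForm (sevenPoint k)) = cubeForm (p k) := fun k => by
    have h2 : sevenEval T p 2 = 2 := map_ofNat _ 2
    have h4 : sevenEval T p 4 = 4 := map_ofNat _ 4
    simp only [cubeForm, map_add, map_mul, sevenEval_point, h2, h4]
  have h2 : ∀ k, sevenEval T p (1 - sevenField * dVeronese (sevenPoint k)).det =
      (1 - T * dVeronese (p k)).det := fun k => by
    rw [RingHom.map_det, map_sub, map_one, RingHom.mapMatrix_apply, sevenEval_jacobian]
  simp only [sevenOpen, map_mul, map_prod, map_sub, h1, h2]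

/-- Each equation involves one point only, so the Jacobian matrix of the system is block diagonal
with blocks `M - 1`. -/
theorem sevenEval_pderiv (q r : Fin 7 × Fin 3) :
    sevenEval T p (pderiv q (sevenEq r)) =
      if q.1 = r.1 then (T * dVeronese (p r.1) - 1 : Matrix (Fin 3) (Fin 3) ℂ) r.2 q.2 else 0 := by
  have hT : sevenField.map (pderiv q) = 0 := by
    ext i J : 1
    simp [sevenField]
  have hp : (fun i => pderiv q (sevenPoint r.1 i)) =
      if q.1 = r.1 then Pi.single q.2 1 else 0 := by
    ext i : 1
    obtain ⟨l, j⟩ := q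
    obtain ⟨k, i'⟩ := r
    simp only [sevenPoint, pderiv_X, Pi.single_apply, Prod.mk.injEq]
    by_cases hk : l = k
    · by_cases hi : i = j <;> simp [hk, hi]
    · simp [hk, Ne.symm hk]
  have hmain : pderiv q (sevenEq r) = ((sevenField * dVeronese (sevenPoint r.1)) *ᵥ
      fun i => pderiv q (sevenPoint r.1 i)) r.2 - pderiv q (sevenPoint r.1 r.2) := by
    rw [sevenEq, map_sub, Derivation.map_matrix_mulVec, hT, Matrix.zero_mulVec, Pi.zero_apply,
      zero_add, ← Matrix.mulVec_mulVec]
    congr 2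
    ext J : 1
    exact (Derivation.map_veronese (pderiv q) (sevenPoint r.1) J)
  rw [hmain, hp, show pderiv q (sevenPoint r.1 r.2) = _ from congrFun hp r.2]
  split_ifs with h
  · rw [Matrix.mulVec_single_one, map_sub, Matrix.sub_apply, ← sevenEval_jacobian]
    congr 1
    rw [Matrix.one_apply, Pi.single_apply]
    split_ifs <;> simp
  · simp

end SevenPoints

theorem cubeField_mulVec_veronese (z : Fin 3 → ℂ) : cubeField *ᵥ veronese z = fun i => z i ^ 2 := by
  ext i
  simp only [cubeField, Matrix.mulVec, dotProduct, Matrix.of_apply, ite_mul, one_mul, zero_mul,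
    Finset.sum_ite_eq', Finset.mem_univ, if_true]
  fin_cases i <;> simp [firstThree, veronese, quadIdx, sq]

theorem cubeField_mul_dVeronese (z : Fin 3 → ℂ) :
    cubeField * dVeronese z = Matrix.diagonal fun i => 2 * z i := by
  rw [dVeronese_eq]
  ext i j
  rw [Matrix.mul_apply]
  simp only [cubeField, Matrix.of_apply, ite_mul, one_mul, zero_mul, Finset.sum_ite_eq',
    Finset.mem_univ, if_true]
  fin_cases i <;> fin_cases j <;> simp [firstThree]

theorem cubePoint_zero_or_one (k : Fin 7) (i : Fin 3) : cubePoint k i = 0 ∨ cubePoint k i = 1 := by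
  fin_cases k <;> fin_cases i <;> simp [cubePoint]

theorem cubeForm_cubePoint (k : Fin 7) : cubeForm (cubePoint k) = (k : ℕ) + 1 := by
  fin_cases k <;> simp [cubePoint, cubeForm] <;> norm_num

-- The field `x², y², z²` fixes the vertices of the unit cube. There the Jacobian matrix of the
-- system is diagonal with entries `2 p - 1 = ±1`, so the seven nonzero vertices persist under
-- generic deformation.
open MvPolynomial in
theorem genericallyMatrix_seven_points :
    QuadVF.GenericallyMatrix fun T => ∃ p : Fin 7 → Fin 3 → ℂ, Function.Injective p ∧
      ∀ k, p k ≠ 0 ∧ T *ᵥ veronese (p k) = p k ∧ (1 - T * dVeronese (p k)).det ≠ 0 := by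
  have hne : ∀ k i, 2 * cubePoint k i - 1 ≠ 0 := fun k i => by
    rcases cubePoint_zero_or_one k i with h | h <;> rw [h] <;> norm_num
  have h1 : ∀ q, sevenEval cubeField cubePoint (sevenEq q) = 0 := fun q => by
    rw [sevenEval_eq, cubeField_mulVec_veronese]
    rcases cubePoint_zero_or_one q.1 q.2 with h | h <;> simp [h]
  have h2 : sevenEval cubeField cubePoint sevenOpen ≠ 0 := by
    rw [sevenEval_open, mul_ne_zero_iff, Finset.prod_ne_zero_iff, Finset.prod_ne_zero_iff]
    constructor
    · intro k _
      refine mul_ne_zero ?_ ?_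
      · rw [cubeForm_cubePoint]
        exact Nat.cast_add_one_ne_zero _
      · rw [cubeField_mul_dVeronese, ← Matrix.diagonal_one, Matrix.diagonal_sub,
          Matrix.det_diagonal, Finset.prod_ne_zero_iff]
        intro i _ h
        exact hne k i (by linear_combination -h)
    · rintro ⟨k, l⟩ hkl h
      rw [cubeForm_cubePoint, cubeForm_cubePoint, sub_eq_zero] at h
      have : (k : ℕ) = l := by exact_mod_cast add_right_cancel h
      simp [Fin.ext_iff, this] at hkl
  have h3 : (Matrix.of fun q r => eval₂ (eval fun q => cubeField q.1 q.2)
      (fun q => cubePoint q.1 q.2) (pderiv q (sevenEq r))).det ≠ 0 := by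
    have : (Matrix.of fun q r => eval₂ (eval fun q => cubeField q.1 q.2)
        (fun q => cubePoint q.1 q.2) (pderiv q (sevenEq r))) =
        Matrix.diagonal fun q : Fin 7 × Fin 3 => 2 * cubePoint q.1 q.2 - 1 := by
      ext q r
      change sevenEval cubeField cubePoint (pderiv q (sevenEq r)) = _
      rw [sevenEval_pderiv, cubeField_mul_dVeronese, ← Matrix.diagonal_one, Matrix.diagonal_sub]
      obtain ⟨l, j⟩ := q
      obtain ⟨k, i⟩ := r
      simp only [Matrix.diagonal_apply, Prod.mk.injEq]
      by_cases hk : l = k <;> by_cases hi : i = j <;> simp [hk, hi]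
      exact fun h => absurd h.symm hi
    rw [this, Matrix.det_diagonal, Finset.prod_ne_zero_iff]
    exact fun q _ => hne q.1 q.2
  obtain ⟨F, hF0, hF⟩ := exists_eval_ne_zero_forall_exists_zero sevenEq sevenOpen
    (fun q => cubeField q.1 q.2) (fun q => cubePoint q.1 q.2) h1 h2 h3
  refine ⟨F, fun h => hF0 (by rw [h, map_zero]), fun T hT => ?_⟩
  obtain ⟨y, hy, hyG⟩ := hF _ hT
  let p : Fin 7 → Fin 3 → ℂ := fun k i => y (k, i)
  have hopen : sevenEval T p sevenOpen ≠ 0 := hyG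
  have heq : ∀ q, sevenEval T p (sevenEq q) = 0 := hy
  rw [sevenEval_open, mul_ne_zero_iff, Finset.prod_ne_zero_iff, Finset.prod_ne_zero_iff] at hopen
  simp only [sevenEval_eq, sub_eq_zero] at heq
  refine ⟨p, fun k l hkl => ?_, fun k => ⟨?_, funext fun i => heq (k, i), ?_⟩⟩
  · by_contra h
    exact hopen.2 (k, l) (by simpa using h) (by simp only [hkl, sub_self])
  · intro h
    apply left_ne_zero_of_mul (hopen.1 k (Finset.mem_univ k))
    rw [h]
    simp [cubeForm]
  · exact right_ne_zero_of_mul (hopen.1 k (Finset.mem_univ k))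

/-! ### Linear changes of coordinates, and finiteness of the classes. -/

section LinearChange

variable {T : Matrix (Fin 3) (Fin 6) ℂ} {A : Matrix (Fin 3) (Fin 3) ℂ}

/-- The terms linear in `w` of `veronese (A *ᵥ (z + w))`, expanded in two ways. -/
theorem symSquare_mul_dVeronese (A : Matrix (Fin 3) (Fin 3) ℂ) (z : Fin 3 → ℂ) :
    symSquare A * dVeronese z = dVeronese (A *ᵥ z) * A := by
  have h : ∀ w, (symSquare A * dVeronese z) *ᵥ w = (dVeronese (A *ᵥ z) * A) *ᵥ w := by
    intro w
    rw [← Matrix.mulVec_mulVec, ← Matrix.mulVec_mulVec]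
    have e1 := veronese_add z w
    have e2 := veronese_add (A *ᵥ z) (A *ᵥ w)
    rw [← Matrix.mulVec_add, veronese_mulVec, veronese_mulVec, veronese_mulVec, e1,
      Matrix.mulVec_add, Matrix.mulVec_add] at e2
    exact add_left_cancel (add_right_cancel e2)
  exact Matrix.ext_of_mulVec_single fun i => h _

/-- The field `T` in the coordinates given by the matrix `A`. -/
noncomputable def conjField (A : Matrix (Fin 3) (Fin 3) ℂ) (T : Matrix (Fin 3) (Fin 6) ℂ) :
    Matrix (Fin 3) (Fin 6) ℂ := A * T * symSquare A⁻¹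

theorem conjField_mulVec (hA : IsUnit A.det) (z : Fin 3 → ℂ) :
    conjField A T *ᵥ veronese (A *ᵥ z) = A *ᵥ (T *ᵥ veronese z) := by
  rw [conjField, ← Matrix.mulVec_mulVec, ← veronese_mulVec, Matrix.mulVec_mulVec,
    Matrix.nonsing_inv_mul _ hA, Matrix.one_mulVec, Matrix.mulVec_mulVec]

theorem conjField_mul_dVeronese (hA : IsUnit A.det) (z : Fin 3 → ℂ) :
    conjField A T * dVeronese (A *ᵥ z) = A * (T * dVeronese z) * A⁻¹ := by
  rw [conjField, Matrix.mul_assoc, symSquare_mul_dVeronese, Matrix.mulVec_mulVec,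
    Matrix.nonsing_inv_mul _ hA, Matrix.one_mulVec]
  simp only [Matrix.mul_assoc]

theorem trace_conjField (hA : IsUnit A.det) (z : Fin 3 → ℂ) :
    (conjField A T * dVeronese (A *ᵥ z)).trace = (T * dVeronese z).trace := by
  rw [conjField_mul_dVeronese hA, Matrix.trace_mul_comm, ← Matrix.mul_assoc,
    Matrix.nonsing_inv_mul _ hA, Matrix.one_mul]

theorem det_conjField (hA : IsUnit A.det) (z : Fin 3 → ℂ) :
    (1 - conjField A T * dVeronese (A *ᵥ z)).det = (1 - T * dVeronese z).det := by
  have h : 1 - A * (T * dVeronese z) * A⁻¹ = A * (1 - T * dVeronese z) * A⁻¹ := by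
    rw [Matrix.mul_sub, Matrix.sub_mul, Matrix.mul_one, Matrix.mul_nonsing_inv _ hA]
  rw [conjField_mul_dVeronese hA, h, Matrix.det_mul, Matrix.det_mul, mul_right_comm,
    ← Matrix.det_mul, Matrix.mul_nonsing_inv _ hA, Matrix.det_one, one_mul]

theorem finite_fixed_conjField (hA : IsUnit A.det) (hfin : {z | T *ᵥ veronese z = z}.Finite) :
    {z | conjField A T *ᵥ veronese z = z}.Finite := by
  refine (hfin.image fun z => A *ᵥ z).subset fun z hz => ?_
  have hz' : A *ᵥ (A⁻¹ *ᵥ z) = z := by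
    rw [Matrix.mulVec_mulVec, Matrix.mul_nonsing_inv _ hA, Matrix.one_mulVec]
  refine ⟨A⁻¹ *ᵥ z, ?_, hz'⟩
  have h := conjField_mulVec (T := T) hA (A⁻¹ *ᵥ z)
  rw [hz', show conjField A T *ᵥ veronese z = z from hz] at h
  change T *ᵥ veronese (A⁻¹ *ᵥ z) = A⁻¹ *ᵥ z
  have h' : A⁻¹ *ᵥ z = A⁻¹ *ᵥ (A *ᵥ (T *ᵥ veronese (A⁻¹ *ᵥ z))) := congrArg _ h
  rw [Matrix.mulVec_mulVec _ A⁻¹ A, Matrix.nonsing_inv_mul _ hA, Matrix.one_mulVec] at h'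
  exact h'.symm

end LinearChange

theorem exists_matrix_mulVec_eq {u v : Fin 3 → Fin 3 → ℂ} (hu : (Matrix.of u).det ≠ 0)
    (hv : (Matrix.of v).det ≠ 0) :
    ∃ A : Matrix (Fin 3) (Fin 3) ℂ, IsUnit A.det ∧ ∀ i, A *ᵥ u i = v i := by
  have hu' : IsUnit (Matrix.of u)ᵀ.det := by
    rw [Matrix.det_transpose]
    exact isUnit_iff_ne_zero.mpr hu
  have hA : (Matrix.of v)ᵀ * (Matrix.of u)ᵀ⁻¹ * (Matrix.of u)ᵀ = (Matrix.of v)ᵀ := by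
    rw [Matrix.mul_assoc, Matrix.nonsing_inv_mul _ hu', Matrix.mul_one]
  refine ⟨(Matrix.of v)ᵀ * (Matrix.of u)ᵀ⁻¹, ?_, fun i => ?_⟩
  · have h := congrArg Matrix.det hA
    rw [Matrix.det_mul, Matrix.det_transpose (Matrix.of v)] at h
    rw [isUnit_iff_ne_zero]
    intro h0
    rw [h0, zero_mul] at h
    exact hv h.symm
  · ext j
    exact congrFun (congrFun hA j) i

/-- Three of seven fixed points are linearly independent. -/
theorem exists_embedding_det_ne_zero {T : Matrix (Fin 3) (Fin 6) ℂ}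
    (hfin : {z | T *ᵥ veronese z = z}.Finite) {y : Fin 7 → Fin 3 → ℂ}
    (hy : ∀ k, T *ᵥ veronese (y k) = y k) (hinj : Function.Injective y) (hy0 : ∀ k, y k ≠ 0) :
    ∃ σ : Fin 6 ↪ Fin 7, (Matrix.of fun i => y (σ (firstThree i))).det ≠ 0 := by
  have hdet : ∀ a b c : Fin 3 → ℂ, (Matrix.of ![a, b, c]).det = c ⬝ᵥ crossProduct a b := by
    intro a b c
    rw [Matrix.det_fin_three, cross_apply]
    simp [dotProduct, Fin.sum_univ_three]
    ring
  have hw : crossProduct (y 0) (y 1) ≠ 0 := by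
    rw [crossProduct_ne_zero_iff_linearIndependent, LinearIndependent.pair_iff]
    exact fun s t h => eq_zero_of_smul_add_smul_eq_zero (hy 0) (hy 1) (hy0 0) (hy0 1)
      (hinj.ne (by decide)) h
  by_contra! h
  apply hw
  have hmat : ∀ σ : Fin 6 ↪ Fin 7, σ 0 = 0 → σ 1 = 1 →
      y (σ 2) ⬝ᵥ crossProduct (y 0) (y 1) = 0 := by
    intro σ h0 h1
    rw [← hdet, ← h σ]
    congr 2
    ext i
    fin_cases i
    · exact (congrFun (congrArg y h0) _).symm
    · exact (congrFun (congrArg y h1) _).symm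
    · rfl
  -- Two embeddings starting with 0, 1 bring the points 2 and 3 to third position. If both
  -- determinants vanished, the points 0 to 3 would be coplanar with the origin.
  have h2 := hmat Fin.castSuccEmb rfl rfl
  have h3 := hmat (Fin.castSuccEmb.trans (Equiv.swap 2 3).toEmbedding)
    (by decide) (by decide)
  refine eq_zero_of_four_fixed hfin (p := fun k : Fin 4 => y (Fin.castLE (by norm_num) k))
    (fun k => hy _) (fun k => hy0 _) (fun a b hab => Fin.castLE_injective _ (hinj hab)) fun k => ?_
  fin_cases k
  · exact dot_self_cross _ _
  · exact dot_cross_self _ _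
  · exact h2
  · exact h3

/-- The first three points of the generic configuration are linearly independent. -/
theorem det_confPoint_ne_zero :
    (Matrix.of fun i => confPoint (firstThree i)).det ≠ 0 := by
  intro h
  have h' := congrArg (confEval basePoints det_veroneseMatrix_basePoints) h
  rw [AlgHom.map_det, map_zero] at h'
  have : (confEval basePoints det_veroneseMatrix_basePoints).mapMatrix
      (Matrix.of fun i => confPoint (firstThree i)) = (1 : Matrix (Fin 3) (Fin 3) ℂ) := by
    ext i j
    refine (confEval_confPoint det_veroneseMatrix_basePoints _ _).trans ?_
    fin_cases i <;> fin_cases j <;> simp [basePoints, firstThree]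
  rw [this, Matrix.det_one] at h'
  exact one_ne_zero h'

namespace QuadVF

theorem coeffMatrix_injective : Function.Injective coeffMatrix := by
  intro X Y h
  funext i
  exact Subtype.ext (by rw [eq_quadPoly X, eq_quadPoly Y, h])

theorem linearlyEquivalent_ofMatrix {A : Matrix (Fin 3) (Fin 3) ℂ} (hA : IsUnit A.det)
    (Y : QuadVF 3) : LinearlyEquivalent Y (ofMatrix (conjField A Y.coeffMatrix)) := by
  refine ⟨Matrix.toLinearEquiv' A (Matrix.invertibleOfIsUnitDet A hA), fun z => ?_⟩
  rw [value_eq, coeffMatrix_ofMatrix, value_eq]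
  exact conjField_mulVec hA z

/-- Six of the points of `Y`, the first three independent, are selected by `σ`, and a linear change
moves these three onto the corresponding points of `T`. Traces and determinants are invariant under
it, so the moved six points form a configuration with the same `exponentData` as `p ∘ σ`. Only
finitely many such configurations exist, and each determines the moved field. -/
theorem genericallyMatrix_finite_classes :
    GenericallyMatrix fun T => ∀ p : Fin 7 → Fin 3 → ℂ, Function.Injective p →
      {z | T *ᵥ veronese z = z}.Finite →
      (∀ k, p k ≠ 0 ∧ T *ᵥ veronese (p k) = p k ∧ (1 - T * dVeronese (p k)).det ≠ 0) →
      ∃ S : Set (QuadVF 3), S.Finite ∧ ∀ Y : QuadVF 3,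
        {z | Y.coeffMatrix *ᵥ veronese z = z}.Finite → ∀ y : Fin 7 → Fin 3 → ℂ,
        Function.Injective y → (∀ k, y k ≠ 0) → (∀ k, Y.coeffMatrix *ᵥ veronese (y k) = y k) →
        (∀ k, (Y.coeffMatrix * dVeronese (y k)).trace = (T * dVeronese (p k)).trace) →
        (∀ k, (1 - Y.coeffMatrix * dVeronese (y k)).det = (1 - T * dVeronese (p k)).det) →
        ∃ Z ∈ S, LinearlyEquivalent Y Z := by
  obtain ⟨c, hc0, hc⟩ := exists_ne_zero_finite_configurations
  -- The second factor ensures that the first three points of each `p ∘ σ` are independent and can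
  -- serve as the target of the linear change.
  obtain ⟨F, hF0, hF⟩ := genericallyMatrix_confEval_ne_zero (mul_ne_zero hc0 det_confPoint_ne_zero)
  refine ⟨F, hF0, fun T hT p hpinj hTfin hp => ?_⟩
  have hdet : ∀ σ : Fin 6 ↪ Fin 7, (veroneseMatrix (p ∘ σ)).det ≠ 0 := fun σ =>
    det_veroneseMatrix_ne_zero hTfin (fun k => (hp k).2.1) hpinj (fun k => (hp k).1)
      (fun k => (hp k).2.2) σ
  have hfixσ : ∀ (σ : Fin 6 ↪ Fin 7) k, T *ᵥ veronese ((p ∘ σ) k) = (p ∘ σ) k :=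
    fun σ k => (hp (σ k)).2.1
  have hG : ∀ σ : Fin 6 ↪ Fin 7, confEval (p ∘ σ) (hdet σ) c ≠ 0 ∧
      (Matrix.of fun i => p (σ (firstThree i))).det ≠ 0 := by
    intro σ
    have h := hF T hT (p ∘ σ) (hdet σ) (hfixσ σ)
    rw [map_mul, mul_ne_zero_iff, AlgHom.map_det] at h
    refine ⟨h.1, ?_⟩
    convert h.2 using 2
    ext i j
    exact (confEval_confPoint (hdet σ) _ _).symm
  let FS : (Fin 6 ↪ Fin 7) → Set (Fin 6 → Fin 3 → ℂ) := fun σ =>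
    {y | ∃ ψ : ConfRing →ₐ[ℂ] ℂ, (∀ a ∈ exponentData, ψ a = confEval (p ∘ σ) (hdet σ) a) ∧
      ∀ k i, ψ (confPoint k i) = y k i}
  let R : (Fin 6 → Fin 3 → ℂ) → Set (QuadVF 3) := fun y =>
    {Z | (veroneseMatrix y).det ≠ 0 ∧ ∀ k, Z.coeffMatrix *ᵥ veronese (y k) = y k}
  have hR : ∀ y, (R y).Finite := fun y => Set.Subsingleton.finite fun Z hZ Z' hZ' =>
    coeffMatrix_injective (eq_of_mulVec_veronese_eq (isUnit_iff_ne_zero.mpr hZ.1) fun k =>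
      (hZ.2 k).trans (hZ'.2 k).symm)
  -- The embedding `σ` depends on `Y`, so the finite set must allow for all of them.
  refine ⟨⋃ σ, ⋃ y ∈ FS σ, R y, Set.finite_iUnion fun σ =>
    (hc _ (hG σ).1).biUnion fun y _ => hR y, ?_⟩
  intro Y hYfin y hyinj hy0 hy htr hdt
  obtain ⟨σ, hσ⟩ := exists_embedding_det_ne_zero hYfin hy hyinj hy0
  obtain ⟨A, hA, hAy⟩ := exists_matrix_mulVec_eq hσ (hG σ).2
  have hAinj : Function.Injective fun z => A *ᵥ z :=
    Matrix.mulVec_injective_iff_isUnit.mpr ((Matrix.isUnit_iff_isUnit_det A).mpr hA)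
  have hfix : ∀ k, conjField A Y.coeffMatrix *ᵥ veronese (A *ᵥ y k) = A *ᵥ y k := fun k => by
    rw [conjField_mulVec hA, hy]
  have hdety : (veroneseMatrix ((fun k => A *ᵥ y k) ∘ σ)).det ≠ 0 := by
    refine det_veroneseMatrix_ne_zero (finite_fixed_conjField hA hYfin) hfix
      (hAinj.comp hyinj) (fun k h => hy0 k (hAinj (h.trans (Matrix.mulVec_zero A).symm)))
      (fun k => ?_) σ
    -- Simplicity of the fixed points of `Y` is not assumed: it is inherited from `T` through the
    -- equality of determinants.
    rw [det_conjField hA, hdt]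
    exact (hp k).2.2
  have hfixy : ∀ k, conjField A Y.coeffMatrix *ᵥ veronese (((fun k => A *ᵥ y k) ∘ σ) k) =
      ((fun k => A *ᵥ y k) ∘ σ) k := fun k => hfix (σ k)
  refine ⟨ofMatrix (conjField A Y.coeffMatrix), ?_, linearlyEquivalent_ofMatrix hA Y⟩
  refine Set.mem_iUnion.mpr ⟨σ, Set.mem_iUnion₂.mpr ⟨(fun k => A *ᵥ y k) ∘ σ,
    ⟨confEval _ hdety, ?_, fun k i => confEval_confPoint hdety k i⟩, hdety, fun k => ?_⟩⟩
  · rintro a (⟨q, rfl⟩ | ⟨k, rfl⟩ | ⟨k, rfl⟩)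
    · simp only [confEval_confPoint]
      exact congrFun (hAy q.1) q.2
    · simp only [confEval_trace hdety hfixy, confEval_trace (hdet σ) (hfixσ σ)]
      exact (trace_conjField hA _).trans (htr _)
    · simp only [confEval_det hdety hfixy, confEval_det (hdet σ) (hfixσ σ)]
      exact (det_conjField hA _).trans (hdt _)
  · rw [coeffMatrix_ofMatrix]
    exact hfixy k

end QuadVF

/-! ### From radial orbits and exponents to fixed points, traces and determinants. -/

/-- Equal multisets of values mean fibers of equal cardinality, and bijections between fibers glue.
This matches the orbits of two fields with the same exponents. -/
theorem exists_equiv_of_map_univ_eq {α β γ : Type} [Fintype α] [Fintype β] {f : α → γ} {g : β → γ}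
    (h : (Finset.univ : Finset α).val.map f = (Finset.univ : Finset β).val.map g) :
    ∃ e : α ≃ β, ∀ a, g (e a) = f a := by
  classical
  have hcard : ∀ c, Fintype.card {a // f a = c} = Fintype.card {b // g b = c} := by
    intro c
    have := congrArg (Multiset.count c) h
    rw [Multiset.count_map, Multiset.count_map] at this
    rw [Fintype.card_subtype, Fintype.card_subtype]
    simpa only [Finset.card_def, Finset.filter_val, eq_comm] using this
  let e : α ≃ β := (Equiv.sigmaFiberEquiv f).symm.trans
    ((Equiv.sigmaCongrRight fun c => Fintype.equivOfCardEq (hcard c)).trans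
      (Equiv.sigmaFiberEquiv g))
  exact ⟨e, fun a => (Fintype.equivOfCardEq (hcard (f a)) ⟨a, rfl⟩).2⟩

namespace QuadVF

section Orbits

variable {X : QuadVF 3}

theorem RadialOrbit.point_spec (ρ : X.RadialOrbit) (hρ : ρ.IsNondegenerate) :
    ρ.point hρ ∈ ρ.1.submodule ∧ ρ.point hρ ≠ 0 ∧ X.value (ρ.point hρ) = ρ.point hρ :=
  hρ.existsUnique.choose_spec.1

theorem RadialOrbit.eq_of_mem {ρ ρ' : X.RadialOrbit} {a : Fin 3 → ℂ} (ha : a ≠ 0)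
    (h : a ∈ ρ.1.submodule) (h' : a ∈ ρ'.1.submodule) : ρ = ρ' := by
  have key : ∀ q : Projectivization ℂ (Fin 3 → ℂ), a ∈ q.submodule →
      q = Projectivization.mk ℂ a ha := by
    intro q hq
    rw [Projectivization.submodule_eq] at hq
    obtain ⟨c, hc⟩ := Submodule.mem_span_singleton.mp hq
    rw [← q.mk_rep, Projectivization.mk_eq_mk_iff']
    have hc0 : c ≠ 0 := by
      rintro rfl
      exact ha (by rw [← hc, zero_smul])
    exact ⟨c⁻¹, by rw [← hc, smul_smul, inv_mul_cancel₀ hc0, one_smul]⟩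
  exact Subtype.ext ((key _ h).trans (key _ h').symm)

theorem exists_orbit_mem {a : Fin 3 → ℂ} (ha : a ≠ 0) (hfix : X.value a = a) :
    ∃ ρ : X.RadialOrbit, a ∈ ρ.1.submodule := by
  refine ⟨⟨Projectivization.mk ℂ a ha, ?_⟩, ?_⟩
  · intro z hz
    rw [Projectivization.submodule_mk] at hz ⊢
    obtain ⟨c, rfl⟩ := Submodule.mem_span_singleton.mp hz
    rw [value_smul, hfix]
    exact Submodule.smul_mem _ _ (Submodule.mem_span_singleton_self a)
  · rw [Projectivization.submodule_mk]
    exact Submodule.mem_span_singleton_self a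

theorem RadialOrbit.point_eq {ρ : X.RadialOrbit} (hρ : ρ.IsNondegenerate) {a : Fin 3 → ℂ}
    (ha : a ≠ 0) (hfix : X.value a = a) (h : a ∈ ρ.1.submodule) : ρ.point hρ = a :=
  hρ.existsUnique.unique (ρ.point_spec hρ) ⟨h, ha, hfix⟩

/-- The radial orbits of a nondegenerate field correspond to its nonzero fixed points. -/
noncomputable def orbitEquiv (hX : X.IsNondegenerate) :
    X.RadialOrbit ≃ {a : Fin 3 → ℂ // a ≠ 0 ∧ X.coeffMatrix *ᵥ veronese a = a} :=
  Equiv.ofBijective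
    (fun ρ => ⟨ρ.point (hX ρ), (ρ.point_spec (hX ρ)).2.1, by
      rw [← value_eq]; exact (ρ.point_spec (hX ρ)).2.2⟩) <| by
    constructor
    · intro ρ ρ' h
      have h' : ρ.point (hX ρ) = ρ'.point (hX ρ') := congrArg Subtype.val h
      refine RadialOrbit.eq_of_mem (ρ.point_spec (hX ρ)).2.1 (ρ.point_spec (hX ρ)).1 ?_
      rw [h']
      exact (ρ'.point_spec (hX ρ')).1
    · rintro ⟨a, ha, hfix⟩
      rw [← value_eq] at hfix
      obtain ⟨ρ, hρ⟩ := exists_orbit_mem ha hfix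
      exact ⟨ρ, Subtype.ext (RadialOrbit.point_eq (hX ρ) ha hfix hρ)⟩

theorem orbitEquiv_apply (hX : X.IsNondegenerate) (ρ : X.RadialOrbit) :
    (orbitEquiv hX ρ : Fin 3 → ℂ) = ρ.point (hX ρ) := rfl

theorem isNondegenerate_of_forall (h : ∀ z, X.coeffMatrix *ᵥ veronese z = 0 → z = 0) :
    X.IsNondegenerate := fun ρ z _ hz0 hz => hz0 (h z (by rw [← value_eq, hz]))

/-- By Euler's identity `-1` is a root, so the division defining the exponents is exact and they
recover the whole characteristic polynomial. -/
theorem charpoly_eq_of_exponents (ρ : X.RadialOrbit) (hρ : ρ.IsNondegenerate) :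
    (1 - X.jacobian (ρ.point hρ)).charpoly = (Polynomial.X - Polynomial.C (-1)) *
      ((ρ.exponents hρ).map fun u => Polynomial.X - Polynomial.C u).prod := by
  set a := ρ.point hρ with ha
  set N := 1 - X.jacobian a with hN
  obtain ⟨-, ha0, hfix⟩ := ρ.point_spec hρ
  have hroot : N.charpoly.IsRoot (-1) := by
    rw [Polynomial.IsRoot, Matrix.eval_charpoly, ← Matrix.exists_mulVec_eq_zero_iff]
    refine ⟨a, ha0, ?_⟩
    have hM : X.jacobian a *ᵥ a = (2 : ℂ) • a := by
      rw [jacobian_eq, ← Matrix.mulVec_mulVec, dVeronese_self, Matrix.mulVec_smul, ← value_eq,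
        hfix]
    rw [hN, Matrix.sub_mulVec, Matrix.sub_mulVec, hM, Matrix.one_mulVec, Matrix.scalar_apply]
    ext i
    simp
    ring
  have hdiv := Polynomial.mul_divByMonic_eq_iff_isRoot.mpr hroot
  rw [← hdiv]
  congr 1
  have hmonic : (N.charpoly /ₘ (Polynomial.X - Polynomial.C (-1))).Monic := by
    have h1 := N.charpoly_monic
    rw [← hdiv] at h1
    exact (Polynomial.monic_X_sub_C (-1)).of_mul_monic_left h1
  exact (IsAlgClosed.splits _).eq_prod_roots_of_monic hmonic

theorem trace_det_eq_of_exponents {Y : QuadVF 3} {ρ : X.RadialOrbit} {ρ' : Y.RadialOrbit}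
    (hρ : ρ.IsNondegenerate) (hρ' : ρ'.IsNondegenerate)
    (h : ρ.exponentPair hρ = ρ'.exponentPair hρ') :
    (X.coeffMatrix * dVeronese (ρ.point hρ)).trace =
        (Y.coeffMatrix * dVeronese (ρ'.point hρ')).trace ∧
      (1 - X.coeffMatrix * dVeronese (ρ.point hρ)).det =
        (1 - Y.coeffMatrix * dVeronese (ρ'.point hρ')).det := by
  have he : ρ.exponents hρ = ρ'.exponents hρ' := congrArg Subtype.val h
  have hc : (1 - X.coeffMatrix * dVeronese (ρ.point hρ)).charpoly =
      (1 - Y.coeffMatrix * dVeronese (ρ'.point hρ')).charpoly := by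
    rw [← jacobian_eq, ← jacobian_eq, charpoly_eq_of_exponents, charpoly_eq_of_exponents, he]
  constructor
  · have h1 : (1 - X.coeffMatrix * dVeronese (ρ.point hρ)).trace =
        (1 - Y.coeffMatrix * dVeronese (ρ'.point hρ')).trace := by
      rw [Matrix.trace_eq_neg_charpoly_coeff, Matrix.trace_eq_neg_charpoly_coeff, hc]
    rw [Matrix.trace_sub, Matrix.trace_sub] at h1
    exact sub_right_injective h1
  · rw [Matrix.det_eq_sign_charpoly_coeff, Matrix.det_eq_sign_charpoly_coeff, hc]

theorem finite_fixed (hX : X.IsNondegenerate) (h7 : Nat.card X.RadialOrbit = 7) :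
    {z | X.coeffMatrix *ᵥ veronese z = z}.Finite := by
  -- `Nat.card` is 0 on infinite types, so the value 7 includes finiteness.
  have : Finite X.RadialOrbit := Nat.finite_of_card_ne_zero (by omega)
  have h : {a : Fin 3 → ℂ | a ≠ 0 ∧ X.coeffMatrix *ᵥ veronese a = a}.Finite :=
    Set.finite_coe_iff.mp (Finite.of_equiv _ (orbitEquiv hX))
  refine (h.insert 0).subset fun z hz => ?_
  by_cases hz0 : z = 0
  · exact Or.inl hz0
  · exact Or.inr ⟨hz0, hz⟩

/-- Fields with the same exponents have fixed points with the same traces and determinants. -/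
theorem exists_matching {Y : QuadVF 3} {e : Sym (Sym ℂ 2) 7} (hX : e ∈ Psi X) (hY : e ∈ Psi Y)
    {p : Fin 7 → Fin 3 → ℂ} (hinj : Function.Injective p)
    (hp : ∀ k, p k ≠ 0 ∧ X.coeffMatrix *ᵥ veronese (p k) = p k) :
    ∃ y : Fin 7 → Fin 3 → ℂ, Function.Injective y ∧ (∀ k, y k ≠ 0) ∧
      (∀ k, Y.coeffMatrix *ᵥ veronese (y k) = y k) ∧
      (∀ k, (Y.coeffMatrix * dVeronese (y k)).trace = (X.coeffMatrix * dVeronese (p k)).trace) ∧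
      ∀ k, (1 - Y.coeffMatrix * dVeronese (y k)).det =
        (1 - X.coeffMatrix * dVeronese (p k)).det := by
  obtain ⟨⟨hXn, hX7⟩, hXe⟩ := hX
  obtain ⟨⟨hYn, hY7⟩, hYe⟩ := hY
  have : Finite X.RadialOrbit := Nat.finite_of_card_ne_zero (by omega)
  have : Finite Y.RadialOrbit := Nat.finite_of_card_ne_zero (by omega)
  let : Fintype X.RadialOrbit := Fintype.ofFinite _
  let : Fintype Y.RadialOrbit := Fintype.ofFinite _
  obtain ⟨ε, hε⟩ := exists_equiv_of_map_univ_eq (congrArg Subtype.val (hXe.trans hYe.symm))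
  let ρ : Fin 7 → X.RadialOrbit := fun k => (orbitEquiv hXn).symm ⟨p k, hp k⟩
  have hρp : ∀ k, (ρ k).point (hXn (ρ k)) = p k := fun k => by
    rw [← orbitEquiv_apply]
    simp [ρ]
  have hspec := fun k => (ε (ρ k)).point_spec (hYn _)
  have hmatch := fun k => trace_det_eq_of_exponents (hYn (ε (ρ k))) (hXn (ρ k)) (hε (ρ k))
  simp only [hρp] at hmatch
  refine ⟨fun k => (ε (ρ k)).point (hYn _), ?_, fun k => (hspec k).2.1, fun k => ?_,
    fun k => (hmatch k).1, fun k => (hmatch k).2⟩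
  · intro k l hkl
    have h1 : ε (ρ k) = ε (ρ l) := (orbitEquiv hYn).injective (Subtype.ext hkl)
    apply hinj
    rw [← hρp, ← hρp, ε.injective h1]
  · rw [← value_eq]
    exact (hspec k).2.2

theorem card_radialOrbit (hX : (elimMatrix X.coeffMatrix).det ≠ 0) {p : Fin 7 → Fin 3 → ℂ}
    (hinj : Function.Injective p)
    (hp : ∀ k, p k ≠ 0 ∧ X.coeffMatrix *ᵥ veronese (p k) = p k) : Nat.card X.RadialOrbit = 7 := by
  have hn : X.IsNondegenerate :=
    isNondegenerate_of_forall fun z hz => eq_zero_of_det_elimMatrix hX hz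
  let f : Fin 7 → {a : Fin 3 → ℂ // a ≠ 0 ∧ X.coeffMatrix *ᵥ veronese a = a} :=
    fun k => ⟨p k, hp k⟩
  have hf : Function.Bijective f := by
    refine ⟨fun k l h => hinj (congrArg Subtype.val h), ?_⟩
    rintro ⟨a, ha0, ha⟩
    by_contra h
    have hne : ∀ k, p k ≠ a := fun k hk => h ⟨k, Subtype.ext hk⟩
    -- The origin, the seven given points and an eighth nonzero one would be nine distinct fixed
    -- points.
    refine not_injective_of_det_elimMatrix hX
      (p := Fin.cons 0 (Fin.cons a p : Fin 8 → Fin 3 → ℂ)) (fun k => ?_) ?_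
    · refine Fin.cases ?_ (fun k => Fin.cases ha (fun k => (hp k).2) k) k
      simp [veronese_zero]
    · rw [Fin.cons_injective_iff, Fin.cons_injective_iff]
      refine ⟨?_, ?_, hinj⟩
      · rintro ⟨k, hk⟩
        revert hk
        exact Fin.cases ha0 (fun k => (hp k).1) k
      · rintro ⟨k, hk⟩
        exact hne k hk
  rw [Nat.card_congr (orbitEquiv hn), ← Nat.card_congr (Equiv.ofBijective f hf), Nat.card_fin]

end Orbits

end QuadVF

theorem theorem2p1 :
    QuadVF.Generically (n := 3) fun X =>
      ∃ e ∈ QuadVF.Psi X, ∃ S : Set (QuadVF 3), S.Finite ∧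
        ∀ Y : QuadVF 3, e ∈ QuadVF.Psi Y → ∃ Z ∈ S, QuadVF.LinearlyEquivalent Y Z := by
  have hgen := ((genericallyMatrix_det_elimMatrix.and genericallyMatrix_seven_points).and
    QuadVF.genericallyMatrix_finite_classes).generically
  obtain ⟨F, hF0, hF⟩ := hgen
  refine ⟨F, hF0, fun X hX => ?_⟩
  obtain ⟨⟨helim, p, hinj, hp⟩, hclasses⟩ := hF X hX
  have hp' : ∀ k, p k ≠ 0 ∧ X.coeffMatrix *ᵥ veronese (p k) = p k :=
    fun k => ⟨(hp k).1, (hp k).2.1⟩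
  have hn : X.IsNondegenerate :=
    QuadVF.isNondegenerate_of_forall fun z hz => eq_zero_of_det_elimMatrix helim hz
  have h7 := QuadVF.card_radialOrbit helim hinj hp'
  obtain ⟨S, hS, hSY⟩ := hclasses p hinj (QuadVF.finite_fixed hn h7) hp
  refine ⟨X.allExponents hn h7, ⟨⟨hn, h7⟩, rfl⟩, S, hS, fun Y hY => ?_⟩
  obtain ⟨y, hyinj, hy0, hyfix, htr, hdet⟩ :=
    QuadVF.exists_matching (X := X) ⟨⟨hn, h7⟩, rfl⟩ hY hinj hp'
  exact hSY Y (QuadVF.finite_fixed hY.1.1 hY.1.2) y hyinj hy0 hyfix htr hdet
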